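/- Let $\mathbb S^2\subset\mathbb R^3$ be the unit sphere with its surface measure $dS$, and let $H^1(T\mathbb S^2)$ be the Sobolev space of real tangent vector fields on $\mathbb S^2$, that is, of the square integrable tangent fields whose components in $\mathbb R^3$ have weak gradients on $\mathbb S^2$ in $L_2$. For a tangent field $u$ put $u^\perp=u\times s$ at $s\in\mathbb S^2$ (rotation by a right angle, $u^\perp=(u_2,-u_1)$ in a local oriented orthonormal frame), let $\operatorname{div}u$ be the divergence of $u$ on $\mathbb S^2$ in the weak sense, $\int_{\mathbb S^2}\varphi\operatorname{div}u\,dS=-\int_{\mathbb S^2}\langle u,\nabla\varphi\rangle\,dS$ for all $\varphi\in C^\infty(\mathbb S^2)$, and let $\operatorname{rot}u=\operatorname{div}(u^\perp)$. Write $\|\cdot\|$ for the norm of $L_2$. Then for every $u\in H^1(T\mathbb S^2)$ the functions $\operatorname{div}u$ and $\operatorname{rot}u$ exist in $L_2(\mathbb S^2)$, and $$ \|u\|_{L_4}^4\le \vec{\mathrm k}_{\mathrm{Lad}}\,\|u\|^2\left(\|\operatorname{rot}u\|^2+\|\operatorname{div}u\|^2\right),\qquad \vec{\mathrm k}_{\mathrm{Lad}}\le\frac{3\pi}{32},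 $$ where $\vec{\mathrm k}_{\mathrm{Lad}}$ denotes the smallest constant $k\ge 0$ for which the inequality holds for all $u\in H^1(T\mathbb S^2)$ (it exists). -/

import Mathlib

open MeasureTheory
open scoped ContDiff NNReal ENNReal RealInnerProductSpace

namespace SphereField

/-- The Euclidean space `ℝ³`. -/
abbrev E3 : Type := EuclideanSpace ℝ (Fin 3)

/-- The unit sphere `𝕊² ⊂ ℝ³`. -/
abbrev S2 : Type := Metric.sphere (0 : E3) 1

/-- The surface measure `dS` on `𝕊²` (of total mass `4π`). -/
noncomputable def area : Measure S2 := (volume : Measure E3).toSphere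

/-- The field of `ℝ³`-vectors `u` on the sphere is tangent to the sphere (almost everywhere). -/
def IsTangent (u : S2 → E3) : Prop := ∀ᵐ s : S2 ∂area, ⟪(s : E3), u s⟫ = 0

/-- The gradient on the sphere of (the restriction to `𝕊²` of) a smooth function `φ`, as a tangent
vector at `s`: the orthogonal projection of the gradient in `ℝ³` to the plane `s^⊥`.
It depends on the restriction of `φ` to the sphere only, and every smooth function on the sphere
is such a restriction. -/
noncomputable def sphereGrad (φ : E3 → ℝ) (s : S2) : E3 :=
  gradient φ s - ⟪(s : E3), gradient φ s⟫ • (s : E3)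

/-- The divergence on the sphere of (the restriction to `𝕊²` of) a smooth field `X` which is
tangent on `𝕊²`: the trace of the derivative of `X` over the tangent plane `s^⊥`,
that is, the trace over `ℝ³` minus the contribution of the unit normal `s`. For tangent `X` it is
the Riemannian divergence; every smooth tangent field on the sphere is such a restriction. -/
noncomputable def smoothDiv (X : E3 → E3) (s : S2) : ℝ :=
  (∑ i : Fin 3, (fderiv ℝ X s (EuclideanSpace.single i 1)) i) - ⟪(s : E3), fderiv ℝ X s s⟫

/-- The tangent field `G` in `L₂` is the weak gradient of the scalar function `f` on the sphere:
`∫ f div X dS = - ∫ ⟨G, X⟩ dS` for all smooth tangent fields `X`. -/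
def IsWeakGrad (f : S2 → ℝ) (G : S2 → E3) : Prop :=
  MemLp G 2 area ∧ IsTangent G ∧
    ∀ X : E3 → E3, ContDiff ℝ ∞ X → (∀ s : S2, ⟪(s : E3), X s⟫ = 0) →
      ∫ s, f s * smoothDiv X s ∂area = - ∫ s, ⟪G s, X s⟫ ∂area

/-- The Sobolev space `H¹(𝕊²)` of scalar functions. -/
def MemH1 (f : S2 → ℝ) : Prop := MemLp f 2 area ∧ ∃ G : S2 → E3, IsWeakGrad f G

/-- The Sobolev space `H¹(T𝕊²)` of (real) tangent vector fields: the tangent fields whose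
components with respect to the standard basis of `ℝ³` all belong to `H¹(𝕊²)`. -/
def MemH1Tangent (u : S2 → E3) : Prop :=
  IsTangent u ∧ ∀ i : Fin 3, MemH1 (fun s => u s i)

/-- `u^⊥ = u × s`, the rotation of `u` by a right angle in the tangent plane. In a positively
oriented orthonormal frame `(e₁, e₂)` of the tangent plane (with `e₁ × e₂ = s` the outward normal)
it is `(u₁, u₂)^⊥ = (u₂, -u₁)`. -/
noncomputable def perp (u : S2 → E3) (s : S2) : E3 :=
  WithLp.toLp 2 (crossProduct (WithLp.ofLp (u s)) (WithLp.ofLp (s : E3)))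

/-- The scalar function `d` in `L₂` is the divergence of the tangent field `u` in `L₂`:
`∫ d φ dS = - ∫ ⟨u, ∇φ⟩ dS` for all smooth functions `φ` on the sphere. -/
def IsWeakDiv (u : S2 → E3) (d : S2 → ℝ) : Prop :=
  MemLp d 2 area ∧
    ∀ φ : E3 → ℝ, ContDiff ℝ ∞ φ →
      ∫ s, d s * φ s ∂area = - ∫ s, ⟪u s, sphereGrad φ s⟫ ∂area

open Classical in
/-- The divergence `div u` (unique up to a null set; it is `0` by convention when there is none
in `L₂`). -/
noncomputable def div (u : S2 → E3) : S2 → ℝ :=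
  if h : ∃ d : S2 → ℝ, IsWeakDiv u d then h.choose else 0

/-- `rot u = div (u^⊥)`. -/
noncomputable def rot (u : S2 → E3) : S2 → ℝ := div (perp u)

/-- The constant `k` is admissible in the interpolation inequality
`‖u‖_{L₄}⁴ ≤ k ‖u‖² (‖rot u‖² + ‖div u‖²)` on `H¹(T𝕊²)`, `‖·‖` being the norm of `L₂`. -/
def LadyzhenskayaInequality (k : ℝ≥0) : Prop :=
  ∀ u : S2 → E3, MemH1Tangent u →
    eLpNorm u 4 area ^ 4 ≤
      k * eLpNorm u 2 area ^ 2 * (eLpNorm (rot u) 2 area ^ 2 + eLpNorm (div u) 2 area ^ 2)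

end SphereField

/-!
The inequality is a spectral estimate for the vector Laplacian on tangent fields, whose quadratic
form is `‖rot u‖² + ‖div u‖²`, with the eigenvalues `λ = n (n + 1)`, `n ≥ 1`, of multiplicity
`2 (2 n + 1)`.

*Spectral projections.* Eigenspaces are produced by integral operators (`op`), whose kernel is a
polynomial in the zonal variable `s = (1 - ⟨x, y⟩) / 2` times the parallel transport from `y` to `x`
along the great circle (`ker`). With the Jacobi polynomial `J` of degree `n - 1` (`jac`) and its
companion `p`, where `(s p)' = J` and `λ p = 2 J - (1 - s) J'`, the kernel has the divergence
`-λ p ⟨e, x⟩` in one variable (`integral_jac_ker_grad`) and is a gradient plus a rotated gradient in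
the other one (`jac_inner_ker`). The only integration by parts on the sphere is the invariance of
the surface measure under rotations (`integral_rotation`). By these two identities the operators for
different `n` annihilate each other, and normalized they are orthogonal projections (`proj`), for
which Bessel's inequality `∑ λ ‖proj u‖² ≤ ‖div u‖² + ‖rot u‖²` holds
(`sum_lam_mul_normSq_proj_le`). They are complete because kernels with a power of `1 - s` form an
approximate identity (`tendsto_eLpNorm_op_peak`).

*The constant.* The argument is that of Frank, Hundertmark, Jex and Nam. For each level `a` split a
field `w` with finite spectral expansion into a low and a high frequency part by the weights
`a² / (λ² + a²)` and `λ² / (λ² + a²)`. The low part is bounded pointwise by `√a ‖w‖ / 4`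
(`norm_low_le`): this is the addition formula for the eigenfields and the spectral density bound
`∑ (2 n + 1) (a² / (λ² + a²))² ≤ π a / 4` (`sum_mul_cut_sq_le`), where convexity allows the
comparison of the sum with an integral. So the high part is at least `|w| - √a ‖w‖ / 4`, and
integrating the squares over `a > 0` and over the sphere gives
`8 / 3 ∫ |w|⁴ ≤ ‖w‖² (π / 4) ∑ λ ‖proj w‖²`, which is the constant `3 π / 32`
(`integral_trunc_pow_four_le`). Truncations of the expansion and Fatou's lemma extend this to all
fields with weak divergence and rotation in `L₂` (`eLpNorm_four_pow_le`).

*Existence.* For `u` in `H¹` the divergence and the rotation are explicit combinations of the weak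
gradients of the components of `u` (`isWeakDiv_of_components`). The admissible constants form a
closed set, so that there is a least one.
-/

namespace SphereField

/-! ### The cross product and the transport kernel -/

/-- The cross product of `ℝ³` on the Euclidean space `E3`; `perp u s = cross (u s) s`. -/
noncomputable def cross (a b : E3) : E3 :=
  WithLp.toLp 2 (crossProduct (WithLp.ofLp a) (WithLp.ofLp b))

lemma perp_apply (u : S2 → E3) (s : S2) : perp u s = cross (u s) s := rfl

@[simp] lemma cross_zero (a b : E3) : cross a b 0 = a 1 * b 2 - a 2 * b 1 := by
  simp [cross, cross_apply]

@[simp] lemma cross_one (a b : E3) : cross a b 1 = a 2 * b 0 - a 0 * b 2 := by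
  simp [cross, cross_apply]

@[simp] lemma cross_two (a b : E3) : cross a b 2 = a 0 * b 1 - a 1 * b 0 := by
  simp [cross, cross_apply]

lemma inner_eq (a b : E3) : ⟪a, b⟫ = a 0 * b 0 + a 1 * b 1 + a 2 * b 2 := by
  simp [PiLp.inner_apply, Fin.sum_univ_three, mul_comm]

lemma ext3 {a b : E3} (h0 : a 0 = b 0) (h1 : a 1 = b 1) (h2 : a 2 = b 2) : a = b := by
  ext i; fin_cases i <;> assumption

/-- The kernel `(1 + ⟨x, y⟩) v - ⟨v, x⟩ (x + y)`. For points `x, y` of the sphere and `v` tangent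
at `y` it is `1 + ⟨x, y⟩` times the parallel transport of `v` from `y` to `x` along the great
circle; the factor removes the singularity of the transport at `x = -y`. -/
noncomputable def ker (x y v : E3) : E3 := (1 + ⟪x, y⟫) • v - ⟪v, x⟫ • (x + y)

lemma inner_self_sphere (x : S2) : ⟪(x : E3), (x : E3)⟫ = 1 := by
  rw [real_inner_self_eq_norm_sq]; simp

lemma norm_sphere (x : S2) : ‖(x : E3)‖ = 1 := by simp

/-- `ker` takes values in the tangent plane at `x`. -/
lemma inner_ker_left {x y v : E3} (hx : ⟪x, x⟫ = 1) : ⟪x, ker x y v⟫ = 0 := by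
  simp only [ker, inner_sub_right, inner_smul_right, inner_add_right, hx, real_inner_comm x v]
  ring

lemma inner_ker {x y v e : E3} (he : ⟪x, e⟫ = 0) :
    ⟪ker x y v, e⟫ = (1 + ⟪x, y⟫) * ⟪v, e⟫ - ⟪v, x⟫ * ⟪y, e⟫ := by
  simp only [ker, inner_sub_left, real_inner_smul_left, inner_add_left, he]
  ring

/-- The transport from `x` to `y` is the adjoint of the transport from `y` to `x`. -/
lemma inner_ker_symm {x y v e : E3} (he : ⟪x, e⟫ = 0) (hv : ⟪y, v⟫ = 0) :
    ⟪ker x y v, e⟫ = ⟪v, ker y x e⟫ := by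
  rw [inner_ker he, real_inner_comm (ker y x e) v, inner_ker hv, real_inner_comm x y,
    real_inner_comm v e, real_inner_comm e y, real_inner_comm v x]
  ring

lemma inner_ker_self {x y v : E3} (hx : ⟪x, x⟫ = 1) (hy : ⟪y, y⟫ = 1) (hv : ⟪y, v⟫ = 0) :
    ⟪ker x y v, ker x y v⟫ = (1 + ⟪x, y⟫) ^ 2 * ⟪v, v⟫ := by
  rw [inner_ker (inner_ker_left hx)]
  simp only [ker, inner_sub_right, inner_smul_right, inner_add_right, hv, hy, real_inner_comm x y,
    real_inner_comm y v]
  ring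

lemma one_add_inner_nonneg (x y : S2) : 0 ≤ 1 + ⟪(x : E3), (y : E3)⟫ := by
  have := neg_le_of_abs_le (abs_real_inner_le_norm (x : E3) (y : E3))
  simp only [norm_sphere] at this
  linarith

lemma norm_ker {x y : S2} {v : E3} (hv : ⟪(y : E3), v⟫ = 0) :
    ‖ker x y v‖ = (1 + ⟪(x : E3), (y : E3)⟫) * ‖v‖ := by
  rw [← sq_eq_sq₀ (norm_nonneg _) (mul_nonneg (one_add_inner_nonneg x y) (norm_nonneg _)),
    mul_pow, ← real_inner_self_eq_norm_sq, ← real_inner_self_eq_norm_sq,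
    inner_ker_self (inner_self_sphere x) (inner_self_sphere y) hv]

/-- The Lagrange-type identity behind all computations with `ker`: with `n = e × y` for `e ⟂ y`,
the vectors `e, y, n` are orthogonal, and this expands `⟨n, x⟩ (y × x)` for a unit vector `x`. -/
lemma inner_cross_smul_cross {x y e : E3} (hx : ⟪x, x⟫ = 1) (hy : ⟪y, y⟫ = 1) (he : ⟪y, e⟫ = 0) :
    ⟪cross e y, x⟫ • cross y x
      = (1 - ⟪x, y⟫ ^ 2) • e - ⟪e, x⟫ • x + (⟪x, y⟫ * ⟪e, x⟫) • y := by
  have key : ⟪cross e y, x⟫ • cross y x = (⟪y, y⟫ * ⟪x, x⟫ - ⟪x, y⟫ ^ 2) • e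
      - (⟪y, e⟫ * ⟪x, x⟫ - ⟪x, y⟫ * ⟪e, x⟫) • y + (⟪y, e⟫ * ⟪x, y⟫ - ⟪y, y⟫ * ⟪e, x⟫) • x := by
    apply ext3 <;> simp only [inner_eq, cross_zero, cross_one, cross_two, PiLp.sub_apply,
      PiLp.smul_apply, PiLp.add_apply, smul_eq_mul] <;> ring
  rw [key, hx, hy, he]
  module

lemma cross_cross_right {x y e : E3} :
    cross (cross e y) x = ⟪e, x⟫ • y - ⟪x, y⟫ • e := by
  apply ext3 <;> simp [inner_eq] <;> ring

lemma inner_cross_left (a b c : E3) : ⟪cross a b, c⟫ = ⟪a, cross b c⟫ := by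
  simp [inner_eq]; ring

lemma cross_self_inner (a b : E3) : ⟪a, cross a b⟫ = 0 := by
  simp [inner_eq]; ring

lemma cross_inner_self (a b : E3) : ⟪b, cross a b⟫ = 0 := by
  simp [inner_eq]; ring

/-- The transported field as a combination of the rotation fields `x ↦ n × x` and `x ↦ y × x`. -/
lemma ker_eq_rotations {x y e : E3} (hx : ⟪x, x⟫ = 1) (hy : ⟪y, y⟫ = 1) (he : ⟪y, e⟫ = 0) :
    ker x y e = ⟪cross e y, x⟫ • cross y x - (1 + ⟪x, y⟫) • cross (cross e y) x := by
  rw [inner_cross_smul_cross hx hy he, cross_cross_right, ker]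
  module

lemma cross_add_left (a b c : E3) : cross (a + b) c = cross a c + cross b c := by
  apply ext3 <;> simp <;> ring

lemma cross_sub_left (a b c : E3) : cross (a - b) c = cross a c - cross b c := by
  apply ext3 <;> simp <;> ring

lemma cross_smul_left (r : ℝ) (a c : E3) : cross (r • a) c = r • cross a c := by
  apply ext3 <;> simp <;> ring

lemma cross_add_right (a b c : E3) : cross a (b + c) = cross a b + cross a c := by
  apply ext3 <;> simp <;> ring

lemma cross_smul_right (r : ℝ) (a c : E3) : cross a (r • c) = r • cross a c := by
  apply ext3 <;> simp <;> ring

lemma cross_zero_left (c : E3) : cross 0 c = 0 := by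
  apply ext3 <;> simp

/-- The transport commutes with the rotation by a right angle. -/
lemma cross_ker {x y e : E3} (hx : ⟪x, x⟫ = 1) (hy : ⟪y, y⟫ = 1) (he : ⟪y, e⟫ = 0) :
    cross (ker x y e) x = ker x y (cross e y) := by
  have hn : cross (cross e y) y = -e := by
    rw [cross_cross_right, real_inner_comm, he, hy]; module
  have hxx : cross x x = 0 := by apply ext3 <;> simp <;> ring
  rw [ker_eq_rotations (e := cross e y) hx hy (cross_inner_self _ _), hn, ker, cross_sub_left,
    cross_smul_left, cross_smul_left, cross_add_left, hxx, zero_add, inner_neg_left,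
    ← neg_one_smul ℝ e, cross_smul_left]
  module

lemma inner_cross_cross (a b : E3) :
    ⟪cross a b, cross a b⟫ = ⟪a, a⟫ * ⟪b, b⟫ - ⟪a, b⟫ ^ 2 := by
  simp only [inner_eq, cross_zero, cross_one, cross_two]; ring

lemma norm_cross_le (a : E3) (s : S2) : ‖cross a s‖ ≤ ‖a‖ := by
  rw [← sq_le_sq₀ (norm_nonneg _) (norm_nonneg _), ← real_inner_self_eq_norm_sq,
    ← real_inner_self_eq_norm_sq, inner_cross_cross, inner_self_sphere]
  nlinarith [sq_nonneg ⟪a, (s : E3)⟫]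

/-! ### Rotation invariance of the surface measure and zonal integrals -/

instance : IsFiniteMeasure area := inferInstanceAs (IsFiniteMeasure (Measure.toSphere _))

lemma area_real_univ : area.real Set.univ = 4 * Real.pi := by
  rw [area, Measure.toSphere_real_apply_univ, Measure.real, EuclideanSpace.volume_ball_fin_three]
  simp
  rw [ENNReal.toReal_ofReal (by positivity)]; ring

/-- The action of a linear isometry on the unit sphere. -/
noncomputable def sphereMap (R : E3 ≃ₗᵢ[ℝ] E3) (s : S2) : S2 :=
  ⟨R s, by simp⟩

lemma continuous_sphereMap (R : E3 ≃ₗᵢ[ℝ] E3) : Continuous (sphereMap R) := by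
  unfold sphereMap; fun_prop

open scoped Pointwise in
lemma measurePreserving_sphereMap (R : E3 ≃ₗᵢ[ℝ] E3) :
    MeasurePreserving (sphereMap R) area area := by
  refine ⟨(continuous_sphereMap R).measurable, ?_⟩
  ext s hs
  rw [Measure.map_apply (continuous_sphereMap R).measurable hs, area,
    Measure.toSphere_apply' _ hs,
    Measure.toSphere_apply' _ ((continuous_sphereMap R).measurable hs)]
  congr 1
  have h : Set.Ioo (0 : ℝ) 1 • (Subtype.val '' (sphereMap R ⁻¹' s))
      = R ⁻¹' (Set.Ioo (0 : ℝ) 1 • (Subtype.val '' s)) := by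
    ext z
    simp only [Set.mem_smul, Set.mem_image, Set.mem_preimage]
    constructor
    · rintro ⟨r, hr, _, ⟨x, hx, rfl⟩, rfl⟩
      exact ⟨r, hr, _, ⟨_, hx, rfl⟩, by simp [sphereMap]⟩
    · rintro ⟨r, hr, _, ⟨x, hx, rfl⟩, h⟩
      refine ⟨r, hr, _, ⟨sphereMap R.symm x, ?_, rfl⟩, ?_⟩
      · convert hx
        ext1
        simp [sphereMap]
      · apply R.injective
        simp [sphereMap, ← h]
  rw [h]
  exact (R.measurePreserving).measure_preimage_equiv (f := R.toHomeomorph.toMeasurableEquiv) _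

lemma integral_sphereMap (R : E3 ≃ₗᵢ[ℝ] E3) (f : S2 → ℝ) (hf : Continuous f) :
    ∫ s, f (sphereMap R s) ∂area = ∫ s, f s ∂area := by
  have h := (measurePreserving_sphereMap R)
  rw [← integral_map (φ := sphereMap R) h.aemeasurable, h.map_eq]
  exact hf.aestronglyMeasurable

/-- The rotation by the angle `θ` about the axis of the unit vector `v` (Rodrigues' formula). -/
noncomputable def rotFun (v : E3) (θ : ℝ) (x : E3) : E3 :=
  Real.cos θ • x + Real.sin θ • cross v x + ((1 - Real.cos θ) * ⟪v, x⟫) • v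

lemma norm_rotFun {v : E3} (hv : ⟪v, v⟫ = 1) (θ : ℝ) (x : E3) : ‖rotFun v θ x‖ = ‖x‖ := by
  rw [← sq_eq_sq₀ (norm_nonneg _) (norm_nonneg _), ← real_inner_self_eq_norm_sq,
    ← real_inner_self_eq_norm_sq, rotFun]
  have h1 : ⟪v, cross v x⟫ = 0 := cross_self_inner _ _
  have h2 : ⟪x, cross v x⟫ = 0 := cross_inner_self _ _
  simp only [inner_add_left, inner_add_right, real_inner_smul_left, inner_smul_right,
    inner_cross_cross, h1, h2, real_inner_comm x v, real_inner_comm v (cross v x), hv,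
    real_inner_comm x (cross v x)]
  have h3 : ⟪x, v⟫ = ⟪v, x⟫ := real_inner_comm _ _
  have := Real.sin_sq_add_cos_sq θ
  simp only [h3]
  linear_combination (⟪x, x⟫ - ⟪v, x⟫ ^ 2) * this

/-- Rodrigues' rotation as a linear isometry. -/
noncomputable def rotIso {v : E3} (hv : ⟪v, v⟫ = 1) (θ : ℝ) : E3 ≃ₗᵢ[ℝ] E3 :=
  LinearIsometry.toLinearIsometryEquiv
    { toFun := rotFun v θ
      map_add' := fun x y => by
        simp only [rotFun, cross_add_right, inner_add_right]; module
      map_smul' := fun r x => by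
        simp only [rotFun, cross_smul_right, inner_smul_right, RingHom.id_apply]; module
      norm_map' := norm_rotFun hv θ } rfl

@[fun_prop]
lemma continuous_cross : Continuous fun p : E3 × E3 => cross p.1 p.2 := by
  unfold cross
  simp only [cross_apply]
  fun_prop

@[fun_prop]
lemma _root_.Continuous.cross {X : Type*} [TopologicalSpace X] {f g : X → E3} (hf : Continuous f)
    (hg : Continuous g) : Continuous fun x => cross (f x) (g x) :=
  continuous_cross.comp (hf.prodMk hg)

lemma hasDerivAt_rotFun (v x : E3) (θ : ℝ) :
    HasDerivAt (fun θ => rotFun v θ x)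
      (-Real.sin θ • x + Real.cos θ • cross v x + (Real.sin θ * ⟪v, x⟫) • v) θ := by
  unfold rotFun
  have h1 := (Real.hasDerivAt_cos θ).smul_const x
  have h2 := (Real.hasDerivAt_sin θ).smul_const (cross v x)
  have h3 := (((Real.hasDerivAt_cos θ).const_sub 1).mul_const ⟪v, x⟫).smul_const v
  simpa using (h1.fun_add h2).fun_add h3

/-- The velocity of the rotation `rotFun v θ x` with respect to `θ`. -/
noncomputable def rotVel (v : E3) (θ : ℝ) (x : E3) : E3 :=
  -Real.sin θ • x + Real.cos θ • cross v x + (Real.sin θ * ⟪v, x⟫) • v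

lemma continuous_rotFun (v : E3) : Continuous fun p : ℝ × S2 => rotFun v p.1 p.2 := by
  unfold rotFun; fun_prop

lemma continuous_rotVel (v : E3) : Continuous fun p : ℝ × S2 => rotVel v p.1 p.2 := by
  unfold rotVel; fun_prop

lemma hasDerivAt_integral_rotFun (v : E3) {f : E3 → ℝ} (hf : ContDiff ℝ 1 f) :
    HasDerivAt (fun θ => ∫ s : S2, f (rotFun v θ s) ∂area)
      (∫ s : S2, fderiv ℝ f (rotFun v 0 s) (rotVel v 0 s) ∂area) 0 := by
  have hf' : Continuous (fderiv ℝ f) := hf.continuous_fderiv one_ne_zero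
  have hF'c : Continuous fun p : ℝ × S2 =>
      fderiv ℝ f (rotFun v p.1 p.2) (rotVel v p.1 p.2) :=
    (hf'.comp (continuous_rotFun v)).clm_apply (continuous_rotVel v)
  obtain ⟨C, hC⟩ := ((isCompact_Icc (a := (-1 : ℝ)) (b := 1)).prod
    (isCompact_univ (X := S2))).exists_bound_of_continuousOn hF'c.continuousOn
  have hcont : ∀ θ : ℝ, Continuous fun s : S2 => f (rotFun v θ s) := fun θ => by
    have h : Continuous fun s : S2 => rotFun v θ s := by unfold rotFun; fun_prop
    exact hf.continuous.comp h
  have hderiv : ∀ (s : S2) (θ : ℝ), HasDerivAt (fun θ => f (rotFun v θ s))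
      (fderiv ℝ f (rotFun v θ s) (rotVel v θ s)) θ := fun s θ =>
    ((hf.differentiable one_ne_zero).differentiableAt.hasFDerivAt).comp_hasDerivAt θ
      (hasDerivAt_rotFun v s θ)
  refine (hasDerivAt_integral_of_dominated_loc_of_deriv_le (μ := area) (x₀ := (0 : ℝ))
    (F' := fun θ (s : S2) => fderiv ℝ f (rotFun v θ s) (rotVel v θ s)) (s := Set.Ioo (-1) 1)
    (bound := fun _ => C) (Ioo_mem_nhds (by norm_num) (by norm_num))
    (Filter.Eventually.of_forall fun θ => (hcont θ).aestronglyMeasurable) ?_ ?_ ?_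
    (integrable_const C) (Filter.Eventually.of_forall fun s θ _ => hderiv s θ)).2
  · exact (hcont 0).integrable_of_hasCompactSupport (HasCompactSupport.of_compactSpace _)
  · exact (hF'c.comp (Continuous.prodMk_right 0)).aestronglyMeasurable
  · exact Filter.Eventually.of_forall fun s θ hθ =>
      hC (θ, s) ⟨Set.Ioo_subset_Icc_self hθ, Set.mem_univ _⟩

lemma integral_rotation_unit {v : E3} (hv : ⟪v, v⟫ = 1) {f : E3 → ℝ} (hf : ContDiff ℝ 1 f) :
    ∫ s : S2, fderiv ℝ f s (cross v s) ∂area = 0 := by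
  have hconst : ∀ θ : ℝ, ∫ s : S2, f (rotFun v θ s) ∂area = ∫ s : S2, f s ∂area := fun θ =>
    integral_sphereMap (rotIso hv θ) (fun s : S2 => f s)
      (hf.continuous.comp continuous_subtype_val)
  have h0 := hasDerivAt_integral_rotFun v hf
  simp only [hconst] at h0
  have := h0.unique (hasDerivAt_const (0 : ℝ) (∫ s : S2, f s ∂area))
  simpa [rotVel, rotFun] using this

/-- Rotations preserve the surface measure; infinitesimally, the integral over the sphere of the
derivative of a function along a rotation field `s ↦ v × s` vanishes. This is the only integration
by parts on the sphere that is needed. -/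
theorem integral_rotation (v : E3) {f : E3 → ℝ} (hf : ContDiff ℝ 1 f) :
    ∫ s : S2, fderiv ℝ f s (cross v s) ∂area = 0 := by
  by_cases hv : v = 0
  · simp [hv, cross_zero_left]
  have h := integral_rotation_unit (v := ‖v‖⁻¹ • v) (by
    rw [real_inner_self_eq_norm_sq, norm_smul]; simp [hv]) hf
  simp only [cross_smul_left, map_smul, smul_eq_mul, integral_const_mul] at h
  simpa [hv] using h

/-- The variable `(1 - ⟨x, y⟩) / 2` of zonal functions; it ranges over `[0, 1]` on the sphere and
vanishes for `x = y`. -/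
noncomputable def hav (x y : E3) : ℝ := (1 - ⟪x, y⟫) / 2

lemma hav_comm (x y : E3) : hav x y = hav y x := by simp [hav, real_inner_comm]

@[fun_prop]
lemma _root_.Continuous.hav {X : Type*} [TopologicalSpace X] {f g : X → E3} (hf : Continuous f)
    (hg : Continuous g) : Continuous fun x => hav (f x) (g x) := by
  unfold SphereField.hav; fun_prop

@[fun_prop]
lemma contDiff_inner_left {n : WithTop ℕ∞} (e : E3) : ContDiff ℝ n fun x : E3 => ⟪e, x⟫ :=
  contDiff_const.inner ℝ contDiff_id

@[fun_prop]
lemma contDiff_hav {n : WithTop ℕ∞} (y : E3) : ContDiff ℝ n fun x => hav x y :=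
  (contDiff_const.sub (contDiff_id.inner ℝ contDiff_const)).div_const 2

lemma one_add_inner_eq_hav (x y : E3) : 1 + ⟪x, y⟫ = 2 * (1 - hav x y) := by
  unfold hav; ring

lemma hav_self (x : S2) : hav x x = 0 := by simp [hav]

lemma hav_nonneg (x y : S2) : 0 ≤ hav x y := by
  have := real_inner_le_norm (x : E3) (y : E3)
  simp only [norm_sphere] at this
  unfold hav; linarith

lemma hav_le_one (x y : S2) : hav x y ≤ 1 := by
  have := one_add_inner_nonneg x y
  rw [one_add_inner_eq_hav] at this; linarith

lemma hasFDerivAt_hav (x y : E3) :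
    HasFDerivAt (fun x => hav x y) (-(1 / 2 : ℝ) • innerSL ℝ y) x := by
  have h : HasFDerivAt (fun x : E3 => ⟪y, x⟫) (innerSL ℝ y) x := (innerSL ℝ y).hasFDerivAt
  have h2 := (h.const_sub 1).const_mul (1 / 2 : ℝ)
  have he : (fun x => hav x y) = fun x => 1 / 2 * (1 - ⟪y, x⟫) := by
    funext x; rw [hav, real_inner_comm]; ring
  rw [he]
  exact h2.congr_fderiv (by ext w; simp)

lemma hasFDerivAt_poly_hav (q : Polynomial ℝ) (x y : E3) :
    HasFDerivAt (fun x => q.eval (hav x y))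
      (q.derivative.eval (hav x y) • -(1 / 2 : ℝ) • innerSL ℝ y) x :=
  HasDerivAt.comp_hasFDerivAt (h₂ := fun t => q.eval t) x (q.hasDerivAt (hav x y))
    (f := fun x => hav x y) (hasFDerivAt_hav x y)

lemma hasFDerivAt_inner_left (e x : E3) :
    HasFDerivAt (fun x : E3 => ⟪e, x⟫) (innerSL ℝ e) x := (innerSL ℝ e).hasFDerivAt

@[fun_prop]
lemma contDiff_poly_hav {n : WithTop ℕ∞} (q : Polynomial ℝ) (y : E3) :
    ContDiff ℝ n fun x => q.eval (hav x y) := by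
  have h : ContDiff ℝ n fun t : ℝ => q.eval t := by
    simpa [Polynomial.aeval_def] using q.contDiff_aeval (𝕜 := ℝ) n
  exact h.comp (contDiff_hav y)

lemma continuous_integrable {E : Type*} [NormedAddCommGroup E] {f : S2 → E} (hf : Continuous f) :
    Integrable f area :=
  hf.integrable_of_hasCompactSupport (HasCompactSupport.of_compactSpace _)

@[fun_prop]
lemma continuous_poly_hav {X : Type*} [TopologicalSpace X] (q : Polynomial ℝ) {f g : X → E3}
    (hf : Continuous f) (hg : Continuous g) : Continuous fun x => q.eval (hav (f x) (g x)) :=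
  q.continuous.comp (hf.hav hg)

lemma inner_single_left (i : Fin 3) (x : E3) : ⟪EuclideanSpace.single i (1 : ℝ), x⟫ = x i := by
  fin_cases i <;> simp [inner_eq]

lemma inner_single_right (i : Fin 3) (x : E3) : ⟪x, EuclideanSpace.single i (1 : ℝ)⟫ = x i := by
  rw [real_inner_comm, inner_single_left]

/-- Integrating the derivatives of `x ↦ x_i q(hav x y)` along the rotations about `e_i × y` and
adding up gives the vanishing of the integral of an exact derivative in the zonal variable. -/
lemma integral_zonal_derivative (q : Polynomial ℝ) (y : S2) :
    ∫ x : S2, ((1 - 2 * hav x y) * q.eval (hav x y)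
      + hav x y * (1 - hav x y) * q.derivative.eval (hav x y)) ∂area = 0 := by
  have h : ∀ i : Fin 3, ∫ x : S2, (⟪EuclideanSpace.single i (1 : ℝ),
        cross (cross (EuclideanSpace.single i 1) y) x⟫ * q.eval (hav x y)
      - (1 / 2) * q.derivative.eval (hav x y) * ⟪EuclideanSpace.single i (1 : ℝ), (x : E3)⟫ *
        ⟪(y : E3), cross (cross (EuclideanSpace.single i 1) y) x⟫) ∂area = 0 := fun i => by
    have h0 := integral_rotation (cross (EuclideanSpace.single i 1) y)
      (f := fun x : E3 => ⟪EuclideanSpace.single i (1 : ℝ), x⟫ * q.eval (hav x y)) (by fun_prop)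
    rw [← h0]
    congr 1
    ext x
    have := ((hasFDerivAt_inner_left (EuclideanSpace.single i (1 : ℝ)) x).mul
      (hasFDerivAt_poly_hav q x y)).fderiv
    erw [this]
    simp
    ring
  have h3 := congrArg₂ (· + ·) (congrArg₂ (· + ·) (h 0) (h 1)) (h 2)
  rw [← integral_add, ← integral_add] at h3
  rotate_left
  iterate 4 exact continuous_integrable (by fun_prop)
  simp only [add_zero] at h3
  rw [← mul_eq_zero_iff_left (show (-2 : ℝ) ≠ 0 by norm_num), ← integral_const_mul, ← h3]
  congr 1
  ext x
  have hx := inner_self_sphere x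
  have hy := inner_self_sphere y
  have hxy : ⟪(x : E3), (y : E3)⟫ = 1 - 2 * hav x y := by unfold hav; ring
  have h1 : ∀ i : Fin 3, ⟪EuclideanSpace.single i (1 : ℝ),
      cross (cross (EuclideanSpace.single i 1) y) x⟫
      = (x : E3) i * (y : E3) i - ⟪(x : E3), (y : E3)⟫ := fun i => by
    rw [cross_cross_right, inner_sub_right, inner_smul_right, inner_smul_right]
    simp only [inner_single_left]
    simp
  have h2 : ∀ i : Fin 3, ⟪(y : E3), cross (cross (EuclideanSpace.single i 1) y) x⟫
      = (x : E3) i - ⟪(x : E3), (y : E3)⟫ * (y : E3) i := fun i => by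
    rw [cross_cross_right, inner_sub_right, inner_smul_right, inner_smul_right, hy,
      inner_single_left, inner_single_right, mul_one]
  have h4 : ∀ i : Fin 3, ⟪EuclideanSpace.single i (1 : ℝ), (x : E3)⟫ = (x : E3) i :=
    fun i => inner_single_left i x
  have hxy' := hxy
  simp only [h1, h2, h4, hxy]
  rw [inner_eq] at hx hy hxy'
  linear_combination (-q.eval (hav x y)
    - (1 / 2) * q.derivative.eval (hav x y) * (1 - 2 * hav x y)) * hxy'
    + (1 / 2) * q.derivative.eval (hav x y) * hx

lemma integral_hav_pow (k : ℕ) (y : S2) :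
    ∫ x : S2, hav x y ^ k ∂area = 4 * Real.pi / (k + 1) := by
  induction k with
  | zero => simp [area_real_univ]
  | succ k ih =>
    have h := integral_zonal_derivative (Polynomial.X ^ k) y
    have h2 : ∀ x : S2, (1 - 2 * hav x y) * (Polynomial.X ^ k : Polynomial ℝ).eval (hav x y)
        + hav x y * (1 - hav x y) * (Polynomial.derivative (Polynomial.X ^ k)).eval (hav x y)
        = (k + 1) * hav x y ^ k - (k + 2) * hav x y ^ (k + 1) := fun x => by
      rcases k with _ | k
      · simp
      · simp; ring
    simp only [h2] at h
    rw [integral_sub, integral_const_mul, integral_const_mul, ih] at h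
    · push_cast
      have : (k : ℝ) + 1 ≠ 0 := by positivity
      field_simp at h ⊢
      linarith
    all_goals exact continuous_integrable (by fun_prop)

/-- Archimedes' theorem for polynomials: the zonal variable is uniformly distributed. -/
theorem integral_zonal (q : Polynomial ℝ) (y : S2) :
    ∫ x : S2, q.eval (hav x y) ∂area = 4 * Real.pi * ∫ t in (0 : ℝ)..1, q.eval t := by
  induction q using Polynomial.induction_on' with
  | add p q hp hq =>
    simp only [Polynomial.eval_add]
    rw [integral_add, intervalIntegral.integral_add, hp, hq, mul_add]
    · exact p.continuous.intervalIntegrable _ _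
    · exact q.continuous.intervalIntegrable _ _
    all_goals exact continuous_integrable (by fun_prop)
  | monomial n a =>
    simp only [Polynomial.eval_monomial, integral_const_mul, intervalIntegral.integral_const_mul,
      integral_hav_pow, integral_pow]
    simp
    ring

lemma integral_zonal' (q : Polynomial ℝ) (x : S2) :
    ∫ y : S2, q.eval (hav x y) ∂area = 4 * Real.pi * ∫ t in (0 : ℝ)..1, q.eval t := by
  simp only [hav_comm (x : E3), integral_zonal]

/-! ### The radial polynomials of the eigenfields -/

open Polynomial

/-- The coefficients `(-m)_k (m + 3)_k / (k!)²` of the hypergeometric polynomial `jac m`. -/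
noncomputable def jacCoeff (m : ℕ) : ℕ → ℝ
  | 0 => 1
  | k + 1 => jacCoeff m k * (((k : ℝ) - m) * (k + m + 3) / ((k : ℝ) + 1) ^ 2)

lemma jacCoeff_succ (m k : ℕ) :
    jacCoeff m (k + 1) = jacCoeff m k * (((k : ℝ) - m) * (k + m + 3) / ((k : ℝ) + 1) ^ 2) := rfl

/-- The Jacobi polynomial `P_m^{(0,2)}(1 - 2s) = ₂F₁(-m, m + 3; 1; s)`: the transport kernel
multiplied by it reproduces the eigenfields of degree `m + 1`. -/
noncomputable def jac (m : ℕ) : ℝ[X] := ∑ k ∈ Finset.range (m + 1), C (jacCoeff m k) * X ^ k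

/-- The companion `₂F₁(-m, m + 3; 2; s)` of `jac m`, proportional to the derivative of the
Legendre polynomial of degree `m + 1`. -/
noncomputable def jacPot (m : ℕ) : ℝ[X] :=
  ∑ k ∈ Finset.range (m + 1), C (jacCoeff m k / (k + 1)) * X ^ k

/-- The eigenvalue `n (n + 1)` of the vector Laplacian of degree `n = m + 1`. -/
noncomputable def lam (m : ℕ) : ℝ := (m + 1) * (m + 2)

lemma lam_pos (m : ℕ) : 0 < lam m := by unfold lam; positivity

lemma lam_injective : Function.Injective lam := by
  intro m n h
  unfold lam at h
  have h1 : ((m : ℝ) - n) * (m + n + 3) = 0 := by linear_combination h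
  rcases mul_eq_zero.1 h1 with h2 | h2
  · exact_mod_cast sub_eq_zero.1 h2
  · have : (0 : ℝ) < m + n + 3 := by positivity
    exact absurd h2 this.ne'

lemma jacCoeff_eq_zero {m k : ℕ} (h : m < k) : jacCoeff m k = 0 := by
  induction k with
  | zero => omega
  | succ k ih =>
    rw [jacCoeff]
    rcases (Nat.lt_succ_iff.1 h).lt_or_eq with h | h
    · rw [ih h, zero_mul]
    · simp [h]

lemma jacCoeff_ne_zero {m k : ℕ} (h : k ≤ m) : jacCoeff m k ≠ 0 := by
  induction k with
  | zero => simp [jacCoeff]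
  | succ k ih =>
    rw [jacCoeff]
    have h1 : (k : ℝ) - m ≠ 0 := by
      rw [sub_ne_zero]; exact_mod_cast (by omega : k ≠ m)
    have h2 : (k : ℝ) + m + 3 ≠ 0 := by positivity
    have h3 : (k : ℝ) + 1 ≠ 0 := by positivity
    have := ih (by omega)
    positivity

lemma coeff_jac (m k : ℕ) : (jac m).coeff k = jacCoeff m k := by
  simp only [jac, finsetSum_coeff, coeff_C_mul, coeff_X_pow, mul_ite, mul_one, mul_zero,
    Finset.sum_ite_eq, Finset.mem_range]
  split_ifs with h
  · rfl
  · rw [jacCoeff_eq_zero (by omega)]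

lemma coeff_jacPot (m k : ℕ) : (jacPot m).coeff k = jacCoeff m k / (k + 1) := by
  simp only [jacPot, finsetSum_coeff, coeff_C_mul, coeff_X_pow, mul_ite, mul_one, mul_zero,
    Finset.sum_ite_eq, Finset.mem_range]
  split_ifs with h
  · rfl
  · rw [jacCoeff_eq_zero (by omega), zero_div]

lemma eval_zero_jac (m : ℕ) : (jac m).eval 0 = 1 := by
  rw [← coeff_zero_eq_eval_zero, coeff_jac, jacCoeff]

/-- The first half of the first-order system, `(s p)' = J`. -/
lemma jac_eq (m : ℕ) : jac m = jacPot m + X * derivative (jacPot m) := by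
  ext k
  rcases k with _ | k
  · simp [coeff_jac, coeff_jacPot]
  · rw [coeff_add, coeff_X_mul, coeff_derivative, coeff_jac, coeff_jacPot]
    push_cast
    field_simp
    ring

/-- The second half of the first-order system, `λ p = 2 J - (1 - s) J'`. -/
lemma lam_jacPot (m : ℕ) :
    C (lam m) * jacPot m = 2 * jac m - derivative (jac m) + X * derivative (jac m) := by
  ext k
  rcases k with _ | k
  · simp [coeff_jac, coeff_jacPot, coeff_derivative, jacCoeff, lam]
    ring
  · rw [coeff_add, coeff_X_mul, coeff_sub, coeff_derivative, coeff_derivative,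
      coeff_ofNat_mul, coeff_C_mul, coeff_jac, coeff_jac, coeff_jacPot, jacCoeff_succ m (k + 1),
      lam]
    push_cast
    field_simp
    ring

/-- The weighted inner product of polynomials on `[0, 1]` which corresponds to the composition of
transport kernels, whose norms are `2 (1 - s)`, at coinciding end points. -/
noncomputable def wip (p q : ℝ[X]) : ℝ := ∫ t in (0 : ℝ)..1, (1 - t) ^ 2 * (p.eval t * q.eval t)

lemma wip_comm (p q : ℝ[X]) : wip p q = wip q p := by
  unfold wip; simp only [mul_comm]

lemma wip_add_right (p q r : ℝ[X]) : wip p (q + r) = wip p q + wip p r := by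
  unfold wip
  rw [← intervalIntegral.integral_add]
  · congr 1; ext t; simp; ring
  all_goals exact Continuous.intervalIntegrable (by fun_prop) _ _

lemma wip_C_mul_right (p q : ℝ[X]) (a : ℝ) : wip p (C a * q) = a * wip p q := by
  unfold wip
  rw [← intervalIntegral.integral_const_mul]
  congr 1; ext t; simp; ring

lemma wip_sum_right {ι : Type*} (p : ℝ[X]) (s : Finset ι) (f : ι → ℝ[X]) :
    wip p (∑ i ∈ s, f i) = ∑ i ∈ s, wip p (f i) := by
  classical
  induction s using Finset.induction_on with
  | empty => simp [wip]
  | insert a s ha ih => rw [Finset.sum_insert ha, Finset.sum_insert ha, wip_add_right, ih]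

lemma integral_derivative (p : ℝ[X]) :
    ∫ t in (0 : ℝ)..1, (derivative p).eval t = p.eval 1 - p.eval 0 :=
  intervalIntegral.integral_eq_sub_of_hasDerivAt (fun t _ => p.hasDerivAt t)
    (p.derivative.continuous.intervalIntegrable _ _)

/-- Green's formula: both sides are the Dirichlet form of the potentials. -/
lemma wip_jac_eq (m n : ℕ) : wip (jac m) (jac n)
    = lam m * ∫ t in (0 : ℝ)..1, t * (1 - t) * ((jacPot m).eval t * (jacPot n).eval t) := by
  have h := integral_derivative ((1 - X) ^ 2 * jac m * (X * jacPot n))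
  have h1 : derivative ((1 - X) ^ 2 * jac m * (X * jacPot n))
      = (1 - X) ^ 2 * (jac m * jac n) - C (lam m) * (X * (1 - X) * (jacPot m * jacPot n)) := by
    have e1 := jac_eq n
    have e2 := lam_jacPot m
    simp only [derivative_mul, derivative_pow, derivative_X, derivative_sub, derivative_one]
    simp only [Nat.cast_ofNat, map_ofNat]
    linear_combination -(1 - X) ^ 2 * jac m * e1 + X * (1 - X) * jacPot n * e2
  rw [h1] at h
  simp only [eval_sub, eval_mul, eval_pow, eval_one, eval_X, eval_C] at h
  rw [intervalIntegral.integral_sub, intervalIntegral.integral_const_mul] at h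
  · unfold wip; linarith
  all_goals exact Continuous.intervalIntegrable (by fun_prop) _ _

lemma wip_jac_ne {m n : ℕ} (h : m ≠ n) : wip (jac m) (jac n) = 0 := by
  have h1 := wip_jac_eq m n
  have h2 := wip_jac_eq n m
  rw [wip_comm] at h2
  simp only [mul_comm ((jacPot n).eval _)] at h2
  set I := ∫ t in (0 : ℝ)..1, t * (1 - t) * ((jacPot m).eval t * (jacPot n).eval t)
  have h3 : (lam m - lam n) * I = 0 := by linarith
  rcases mul_eq_zero.1 h3 with h4 | h4
  · exact absurd (lam_injective (sub_eq_zero.1 h4)) h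
  · rw [h1, h4, mul_zero]

/-- The polynomials `jac 0, …, jac (N - 1)` span the polynomials of degree less than `N`. -/
lemma exists_jac_expansion (N : ℕ) (q : ℝ[X]) (hq : ∀ k, N ≤ k → q.coeff k = 0) :
    ∃ b : ℕ → ℝ, q = ∑ m ∈ Finset.range N, C (b m) * jac m := by
  induction N generalizing q with
  | zero => exact ⟨0, by ext k; simp [hq k]⟩
  | succ N ih =>
    obtain ⟨b, hb⟩ := ih (q - C (q.coeff N / jacCoeff N N) * jac N) (fun k hk => by
      rw [coeff_sub, coeff_C_mul, coeff_jac]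
      rcases hk.eq_or_lt with rfl | hk
      · rw [div_mul_cancel₀ _ (jacCoeff_ne_zero le_rfl), sub_self]
      · rw [hq k hk, jacCoeff_eq_zero hk]; simp)
    refine ⟨fun m => if m = N then q.coeff N / jacCoeff N N else b m, ?_⟩
    rw [Finset.sum_range_succ, ← sub_eq_iff_eq_add]
    simp only [if_true]
    rw [hb]
    refine Finset.sum_congr rfl fun m hm => ?_
    rw [if_neg (Finset.mem_range.1 hm).ne]

lemma wip_jac_of_degree_lt {m : ℕ} {q : ℝ[X]} (hq : ∀ k, m ≤ k → q.coeff k = 0) :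
    wip (jac m) q = 0 := by
  obtain ⟨b, rfl⟩ := exists_jac_expansion m q hq
  rw [wip_sum_right]
  refine Finset.sum_eq_zero fun k hk => ?_
  rw [wip_C_mul_right, wip_jac_ne (Finset.mem_range.1 hk).ne', mul_zero]

/-- Integration by parts in `∫ (1 - s)² J²`, since `(1 - s) J' = - m J` up to lower degree. -/
theorem wip_jac_self (m : ℕ) : wip (jac m) (jac m) = 1 / (2 * m + 3) := by
  have h := integral_derivative ((1 - X) ^ 3 * (jac m * jac m))
  have h1 : derivative ((1 - X) ^ 3 * (jac m * jac m))
      = -(1 - X) ^ 2 * (jac m * (C 3 * jac m + C (-2) * ((1 - X) * derivative (jac m)))) := by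
    simp only [derivative_mul, derivative_pow, derivative_X, derivative_sub, derivative_one]
    simp only [Nat.cast_ofNat, map_ofNat, map_neg]
    ring
  rw [h1] at h
  have h2 : wip (jac m) (C 3 * jac m + C (-2) * ((1 - X) * derivative (jac m))) = 1 := by
    simp only [eval_mul, eval_neg, eval_pow, eval_sub, eval_one, eval_X, eval_zero_jac] at h
    unfold wip
    simp only [neg_mul, intervalIntegral.integral_neg] at h ⊢
    rw [← neg_inj, h]; norm_num
  have h3 : wip (jac m) ((1 - X) * derivative (jac m) + C (m : ℝ) * jac m) = 0 := by
    refine wip_jac_of_degree_lt fun k hk => ?_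
    have e : (1 - X) * derivative (jac m) = derivative (jac m) - derivative (jac m) * X := by ring
    rw [e, coeff_add, coeff_sub, coeff_C_mul, coeff_derivative, coeff_jac, coeff_jac,
      jacCoeff_eq_zero (by omega : m < k + 1)]
    rcases k with _ | k
    · simp at hk; subst hk; simp
    · rw [coeff_mul_X, coeff_derivative, coeff_jac]
      rcases hk.eq_or_lt with rfl | hk
      · push_cast; ring
      · rw [jacCoeff_eq_zero hk]; simp
  rw [wip_add_right, wip_C_mul_right] at h2 h3
  rw [wip_C_mul_right] at h2
  have : (2 * m + 3 : ℝ) ≠ 0 := by positivity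
  field_simp
  linarith

/-! ### Zonal operators on tangent fields -/

lemma norm_ker_le (x y : S2) (v : E3) : ‖ker x y v‖ ≤ 4 * ‖v‖ := by
  have h1 := one_add_inner_nonneg x y
  have h2 : 1 + ⟪(x : E3), (y : E3)⟫ ≤ 2 := by
    rw [one_add_inner_eq_hav]; linarith [hav_nonneg x y]
  have h3 : |⟪v, (x : E3)⟫| ≤ ‖v‖ := by
    simpa using abs_real_inner_le_norm v (x : E3)
  have h4 : ‖(x : E3) + y‖ ≤ 2 := (norm_add_le _ _).trans (by simp; norm_num)
  calc ‖ker x y v‖ ≤ ‖(1 + ⟪(x : E3), (y : E3)⟫) • v‖ + ‖⟪v, (x : E3)⟫ • ((x : E3) + y)‖ :=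
        norm_sub_le _ _
    _ = (1 + ⟪(x : E3), (y : E3)⟫) * ‖v‖ + |⟪v, (x : E3)⟫| * ‖(x : E3) + y‖ := by
        rw [norm_smul, norm_smul, Real.norm_eq_abs, Real.norm_eq_abs, abs_of_nonneg h1]
    _ ≤ 2 * ‖v‖ + ‖v‖ * 2 := by gcongr
    _ = 4 * ‖v‖ := by ring

lemma exists_bound_eval (q : ℝ[X]) : ∃ C, 0 ≤ C ∧ ∀ x y : S2, |q.eval (hav x y)| ≤ C := by
  obtain ⟨C, hC⟩ := (isCompact_Icc (a := (0 : ℝ)) (b := 1)).exists_bound_of_continuousOn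
    q.continuous.continuousOn
  exact ⟨C, (abs_nonneg _).trans (hC 0 (by simp)), fun x y =>
    hC _ ⟨hav_nonneg x y, hav_le_one x y⟩⟩

@[fun_prop]
lemma _root_.Continuous.ker {X : Type*} [TopologicalSpace X] {f g h : X → E3} (hf : Continuous f)
    (hg : Continuous g) (hh : Continuous h) : Continuous fun x => ker (f x) (g x) (h x) := by
  unfold SphereField.ker; fun_prop

lemma aestronglyMeasurable_ker {X : Type*} [MeasurableSpace X] {μ : Measure X}
    {f g h : X → E3} (hf : AEStronglyMeasurable f μ) (hg : AEStronglyMeasurable g μ)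
    (hh : AEStronglyMeasurable h μ) : AEStronglyMeasurable (fun x => ker (f x) (g x) (h x)) μ := by
  have h1 : AEStronglyMeasurable (fun x => 1 + ⟪f x, g x⟫) μ :=
    aestronglyMeasurable_const.add (hf.inner hg)
  have h2 : AEStronglyMeasurable (fun x => ⟪h x, f x⟫) μ := hh.inner hf
  exact (h1.smul hh).sub (h2.smul (hf.add hg))

/-- The zonal operator `u ↦ ∫ q(hav x y) ker x y (u y) dS(y)` on tangent fields. -/
noncomputable def op (q : ℝ[X]) (u : S2 → E3) (x : S2) : E3 :=
  ∫ y, q.eval (hav x y) • ker x y (u y) ∂area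

lemma integrable_op {q : ℝ[X]} {u : S2 → E3} (hu : Integrable u area) (x : S2) :
    Integrable (fun y : S2 => q.eval (hav x y) • ker x y (u y)) area := by
  obtain ⟨C, hC0, hC⟩ := exists_bound_eval q
  refine (hu.norm.const_mul (C * 4)).mono' ?_ (Filter.Eventually.of_forall fun y => ?_)
  · have h1 : AEStronglyMeasurable (fun y : S2 => q.eval (hav x y)) area :=
      Continuous.aestronglyMeasurable (by fun_prop)
    exact h1.smul (aestronglyMeasurable_ker aestronglyMeasurable_const
      continuous_subtype_val.aestronglyMeasurable hu.aestronglyMeasurable)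
  · rw [norm_smul, mul_assoc]
    exact mul_le_mul (hC x y) (norm_ker_le x y _) (norm_nonneg _) hC0

lemma continuous_op {q : ℝ[X]} {u : S2 → E3} (hu : Integrable u area) : Continuous (op q u) := by
  obtain ⟨C, hC0, hC⟩ := exists_bound_eval q
  refine continuous_of_dominated (bound := fun y => C * 4 * ‖u y‖)
    (fun x => (integrable_op hu x).aestronglyMeasurable)
    (fun x => Filter.Eventually.of_forall fun y => ?_) (hu.norm.const_mul (C * 4))
    (Filter.Eventually.of_forall fun y => by fun_prop)
  rw [norm_smul, mul_assoc]
  exact mul_le_mul (hC x y) (norm_ker_le x y _) (norm_nonneg _) hC0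

lemma inner_op {q : ℝ[X]} {u : S2 → E3} (hu : Integrable u area) (x : S2) (e : E3) :
    ⟪op q u x, e⟫ = ∫ y, q.eval (hav x y) * ⟪ker x y (u y), e⟫ ∂area := by
  rw [op, real_inner_comm, ← integral_inner (integrable_op hu x)]
  simp only [inner_smul_right, real_inner_comm e]

lemma inner_left_op {q : ℝ[X]} {u : S2 → E3} (hu : Integrable u area) (x : S2) :
    ⟪(x : E3), op q u x⟫ = 0 := by
  rw [real_inner_comm, inner_op hu]
  simp only [real_inner_comm (x : E3), inner_ker_left (inner_self_sphere x), mul_zero,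
    integral_zero]

lemma isTangent_op {q : ℝ[X]} {u : S2 → E3} (hu : Integrable u area) : IsTangent (op q u) :=
  Filter.Eventually.of_forall fun x => inner_left_op hu x

lemma op_add {q : ℝ[X]} {u v : S2 → E3} (hu : Integrable u area) (hv : Integrable v area) :
    op q (u + v) = op q u + op q v := by
  ext1 x
  rw [Pi.add_apply, op, op, op, ← integral_add (integrable_op hu x) (integrable_op hv x)]
  congr 1; ext1 y
  simp only [ker, Pi.add_apply, inner_add_left]
  module

lemma op_smul {q : ℝ[X]} {u : S2 → E3} (a : ℝ) : op q (a • u) = a • op q u := by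
  ext1 x
  rw [Pi.smul_apply, op, op, ← integral_smul]
  congr 1; ext1 y
  simp only [ker, Pi.smul_apply, real_inner_smul_left]
  module

lemma op_sub {q : ℝ[X]} {u v : S2 → E3} (hu : Integrable u area) (hv : Integrable v area) :
    op q (u - v) = op q u - op q v := by
  have h := op_add (q := q) hu (hv.smul (-1 : ℝ))
  rw [op_smul] at h
  rw [sub_eq_add_neg, sub_eq_add_neg, ← neg_one_smul ℝ v, ← neg_one_smul ℝ (op q v), ← h]

lemma op_C_mul (q : ℝ[X]) (a : ℝ) (u : S2 → E3) : op (C a * q) u = a • op q u := by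
  ext1 x
  rw [Pi.smul_apply, op, op, ← integral_smul]
  simp only [eval_mul, eval_C, mul_smul]

lemma op_poly_sum {ι : Type*} (s : Finset ι) (f : ι → ℝ[X]) {u : S2 → E3}
    (hu : Integrable u area) : op (∑ i ∈ s, f i) u = ∑ i ∈ s, op (f i) u := by
  ext1 x
  rw [Finset.sum_apply]
  simp only [op, eval_finsetSum, Finset.sum_smul]
  exact integral_finsetSum _ fun i _ => integrable_op hu x

lemma op_field_sum {ι : Type*} (q : ℝ[X]) (s : Finset ι) (f : ι → S2 → E3)
    (hf : ∀ i ∈ s, Integrable (f i) area) : op q (∑ i ∈ s, f i) = ∑ i ∈ s, op q (f i) := by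
  classical
  induction s using Finset.induction_on with
  | empty =>
    ext1 x
    simp [op, ker]
  | insert a s ha ih =>
    rw [Finset.sum_insert ha, Finset.sum_insert ha, op_add (hf a (by simp)),
      ih fun i hi => hf i (by simp [hi])]
    exact integrable_finsetSum' _ fun i hi => hf i (by simp [hi])

/-- Fubini's theorem for kernels dominated by a product of integrable functions. -/
lemma integral_swap_of_le {f : S2 → S2 → ℝ} {g h : S2 → ℝ} (C : ℝ)
    (hf : AEStronglyMeasurable (fun p : S2 × S2 => f p.1 p.2) (area.prod area))
    (hg : Integrable g area) (hh : Integrable h area)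
    (hle : ∀ x y, |f x y| ≤ C * (g x * h y)) :
    ∫ x, ∫ y, f x y ∂area ∂area = ∫ y, ∫ x, f x y ∂area ∂area := by
  refine integral_integral_swap ?_
  exact ((hg.mul_prod hh).const_mul C).mono' hf (Filter.Eventually.of_forall fun p => hle _ _)

/-- The zonal operators are symmetric on tangent fields. -/
lemma integral_inner_op_comm (q : ℝ[X]) {u v : S2 → E3} (hu : Integrable u area)
    (hv : Integrable v area) (hut : IsTangent u) (hvt : IsTangent v) :
    ∫ x, ⟪op q u x, v x⟫ ∂area = ∫ x, ⟪u x, op q v x⟫ ∂area := by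
  obtain ⟨C, hC0, hC⟩ := exists_bound_eval q
  have h1 : ∫ x, ⟪op q u x, v x⟫ ∂area
      = ∫ x, ∫ y, q.eval (hav x y) * ⟪ker x y (u y), v x⟫ ∂area ∂area := by
    congr 1; ext1 x; exact inner_op hu x _
  have h2 : ∫ y, ⟪u y, op q v y⟫ ∂area
      = ∫ y, ∫ x, q.eval (hav x y) * ⟪ker x y (u y), v x⟫ ∂area ∂area := by
    refine integral_congr_ae (hut.mono fun y hy => ?_)
    simp only
    rw [real_inner_comm, inner_op hv]
    refine integral_congr_ae (hvt.mono fun x hx => ?_)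
    simp only
    rw [inner_ker_symm hx hy, real_inner_comm, hav_comm]
  rw [h1, h2]
  refine integral_swap_of_le (C * 4) ?_ hv.norm hu.norm fun x y => ?_
  · refine AEStronglyMeasurable.mul (Continuous.aestronglyMeasurable (by fun_prop)) ?_
    refine AEStronglyMeasurable.inner ?_ hv.aestronglyMeasurable.comp_fst
    exact aestronglyMeasurable_ker (continuous_subtype_val.comp continuous_fst).aestronglyMeasurable
      (continuous_subtype_val.comp continuous_snd).aestronglyMeasurable
      hu.aestronglyMeasurable.comp_snd
  · rw [abs_mul]
    calc |q.eval (hav x y)| * |⟪ker x y (u y), v x⟫| ≤ C * (4 * ‖u y‖ * ‖v x‖) := by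
          refine mul_le_mul (hC x y) ((abs_real_inner_le_norm _ _).trans ?_) (abs_nonneg _) hC0
          gcongr
          exact norm_ker_le x y _
      _ = C * 4 * (‖v x‖ * ‖u y‖) := by ring

/-! ### An approximate identity -/

lemma eLpNorm_two_sq {F : Type*} [NormedAddCommGroup F] {f : S2 → F} (hf : MemLp f 2 area) :
    eLpNorm f 2 area ^ 2 = ENNReal.ofReal (∫ s, ‖f s‖ ^ 2 ∂area) := by
  have h := eLpNorm_nnreal_pow_eq_lintegral (μ := area) (f := f) (p := 2) two_ne_zero
  norm_num at h
  rw [h, ofReal_integral_eq_lintegral_ofReal]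
  · congr 1; ext1 s
    rw [ENNReal.ofReal_pow (norm_nonneg _), ofReal_norm]
  · exact (memLp_two_iff_integrable_sq_norm hf.1).1 hf
  · exact Filter.Eventually.of_forall fun s => sq_nonneg _

lemma integrable_normSq {F : Type*} [NormedAddCommGroup F] {f : S2 → F} (hf : MemLp f 2 area) :
    Integrable (fun s => ‖f s‖ ^ 2) area := (memLp_two_iff_integrable_sq_norm hf.1).1 hf

lemma continuous_memLp {F : Type*} [NormedAddCommGroup F] {f : S2 → F} (hf : Continuous f)
    (p : ℝ≥0∞) : MemLp f p area :=
  hf.memLp_of_hasCompactSupport (HasCompactSupport.of_compactSpace _)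

/-- A polynomial in the zonal variable for which `|q(hav x y) ker x y v| / |v|` is a probability
density in each variable. -/
structure IsZonalDensity (q : ℝ[X]) : Prop where
  nonneg : ∀ t ∈ Set.Icc (0 : ℝ) 1, 0 ≤ q.eval t
  mass : ∀ x : S2, ∫ y : S2, q.eval (hav x y) * (2 * (1 - hav x y)) ∂area = 1

lemma IsZonalDensity.eval_nonneg {q : ℝ[X]} (hq : IsZonalDensity q) (x y : S2) :
    0 ≤ q.eval (hav x y) := hq.nonneg _ ⟨hav_nonneg x y, hav_le_one x y⟩

/-- The pointwise Jensen inequality. -/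
lemma normSq_op_le {q : ℝ[X]} (hq : IsZonalDensity q) {u : S2 → E3} (hu : MemLp u 2 area)
    (hut : IsTangent u) (x : S2) :
    ‖op q u x‖ ^ 2 ≤ ∫ y, q.eval (hav x y) * (2 * (1 - hav x y)) * ‖u y‖ ^ 2 ∂area := by
  have hu1 := hu.integrable one_le_two
  have hk : Continuous fun y : S2 => q.eval (hav x y) * (2 * (1 - hav x y)) := by fun_prop
  have hi : Integrable (fun y : S2 => q.eval (hav x y) * (2 * (1 - hav x y)) * ‖u y‖ ^ 2) area := by
    obtain ⟨C, hC⟩ := isCompact_univ.exists_bound_of_continuousOn hk.continuousOn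
    exact (integrable_normSq hu).bdd_mul hk.aestronglyMeasurable
      (Filter.Eventually.of_forall fun y => hC y (Set.mem_univ _))
  set w := op q u x with hw
  have h1 : ⟪w, w⟫ ≤ ∫ y, (1 / 2 * (q.eval (hav x y) * (2 * (1 - hav x y)) * ‖u y‖ ^ 2)
      + 1 / 2 * ‖w‖ ^ 2 * (q.eval (hav x y) * (2 * (1 - hav x y)))) ∂area := by
    conv_lhs => rw [hw, inner_op hu1]
    refine integral_mono_ae ?_ ?_ (hut.mono fun y hy => ?_)
    · have := (integrable_op (q := q) hu1 x).inner_const (𝕜 := ℝ) (op q u x)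
      simpa only [real_inner_smul_left] using this
    · exact (hi.const_mul _).add ((continuous_integrable hk).const_mul _)
    · simp only
      have h2 : ⟪ker x y (u y), op q u x⟫ ≤ 2 * (1 - hav x y) * ‖u y‖ * ‖w‖ := by
        refine (real_inner_le_norm _ _).trans (le_of_eq ?_)
        rw [norm_ker hy, one_add_inner_eq_hav]
      have h3 := hq.eval_nonneg x y
      have h4 : 0 ≤ 1 - hav x y := by linarith [hav_le_one x y]
      calc q.eval (hav x y) * ⟪ker x y (u y), op q u x⟫
          ≤ q.eval (hav x y) * (2 * (1 - hav x y) * ‖u y‖ * ‖w‖) := by gcongr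
        _ = q.eval (hav x y) * (1 - hav x y) * (2 * ‖u y‖ * ‖w‖) := by ring
        _ ≤ q.eval (hav x y) * (1 - hav x y) * (‖u y‖ ^ 2 + ‖w‖ ^ 2) := by
            gcongr; nlinarith [sq_nonneg (‖u y‖ - ‖w‖)]
        _ = _ := by ring
  rw [integral_add (hi.const_mul _) ((continuous_integrable hk).const_mul _), integral_const_mul,
    integral_const_mul, hq.mass, real_inner_self_eq_norm_sq] at h1
  linarith

/-- Zonal densities act as contractions on square integrable tangent fields. -/
lemma eLpNorm_op_le {q : ℝ[X]} (hq : IsZonalDensity q) {u : S2 → E3} (hu : MemLp u 2 area)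
    (hut : IsTangent u) : eLpNorm (op q u) 2 area ≤ eLpNorm u 2 area := by
  have hc : MemLp (op q u) 2 area := continuous_memLp (continuous_op (hu.integrable one_le_two)) 2
  rw [← ENNReal.pow_le_pow_left_iff two_ne_zero, eLpNorm_two_sq hc, eLpNorm_two_sq hu]
  refine ENNReal.ofReal_le_ofReal ?_
  have hk : Continuous fun p : S2 × S2 => q.eval (hav p.1 p.2) * (2 * (1 - hav p.1 p.2)) := by
    fun_prop
  obtain ⟨C, hC⟩ := isCompact_univ.exists_bound_of_continuousOn hk.continuousOn
  have hmeas : AEStronglyMeasurable (fun p : S2 × S2 =>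
      q.eval (hav p.1 p.2) * (2 * (1 - hav p.1 p.2)) * ‖u p.2‖ ^ 2) (area.prod area) :=
    hk.aestronglyMeasurable.mul (hu.1.comp_snd.norm.pow 2)
  have hle : ∀ x y : S2, |q.eval (hav x y) * (2 * (1 - hav x y)) * ‖u y‖ ^ 2|
      ≤ C * (1 * ‖u y‖ ^ 2) := fun x y => by
    rw [abs_mul, one_mul, abs_of_nonneg (sq_nonneg ‖u y‖)]
    gcongr
    exact hC (x, y) (Set.mem_univ _)
  have hprod : Integrable (fun p : S2 × S2 =>
      q.eval (hav p.1 p.2) * (2 * (1 - hav p.1 p.2)) * ‖u p.2‖ ^ 2) (area.prod area) :=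
    (((integrable_const (1 : ℝ)).mul_prod (integrable_normSq hu)).const_mul C).mono' hmeas
      (Filter.Eventually.of_forall fun p => hle p.1 p.2)
  calc ∫ x, ‖op q u x‖ ^ 2 ∂area
      ≤ ∫ x, ∫ y, q.eval (hav x y) * (2 * (1 - hav x y)) * ‖u y‖ ^ 2 ∂area ∂area :=
        integral_mono (integrable_normSq hc) hprod.integral_prod_left
          fun x => normSq_op_le hq hu hut x
    _ = ∫ y, ∫ x, q.eval (hav x y) * (2 * (1 - hav x y)) * ‖u y‖ ^ 2 ∂area ∂area :=
        integral_integral_swap hprod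
    _ = ∫ y, ‖u y‖ ^ 2 ∂area := by
        congr 1; ext1 y
        rw [integral_mul_const]
        have := hq.mass y
        simp only [hav_comm (y : E3)] at this
        rw [this, one_mul]

/-- The densities `(k + 2) / (8 π) (1 - s)^k`, which concentrate on the diagonal. -/
noncomputable def peak (k : ℕ) : ℝ[X] := C ((k + 2) / (8 * Real.pi)) * (1 - X) ^ k

lemma integral_one_sub_pow (k : ℕ) : ∫ t in (0 : ℝ)..1, (1 - t) ^ k = 1 / (k + 1) := by
  rw [intervalIntegral.integral_comp_sub_left (fun t => t ^ k)]
  simp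

lemma isZonalDensity_peak (k : ℕ) : IsZonalDensity (peak k) where
  nonneg t ht := by
    have : 0 ≤ 1 - t := by linarith [ht.2]
    simp only [peak, eval_mul, eval_C, eval_pow, eval_sub, eval_one, eval_X]
    positivity
  mass x := by
    have h := integral_zonal' (peak k * (2 * (1 - X))) x
    simp only [peak, eval_mul, eval_C, eval_pow, eval_sub, eval_one, eval_X, eval_ofNat] at h ⊢
    rw [h]
    have h2 : ∀ t : ℝ, ((k : ℝ) + 2) / (8 * Real.pi) * (1 - t) ^ k * (2 * (1 - t))
        = ((k : ℝ) + 2) / (4 * Real.pi) * (1 - t) ^ (k + 1) := fun t => by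
      field_simp; ring
    simp only [h2, intervalIntegral.integral_const_mul, integral_one_sub_pow]
    have := Real.pi_ne_zero
    push_cast
    field_simp
    ring

lemma integral_peak (k : ℕ) (x : S2) :
    ∫ y : S2, (peak k).eval (hav x y) ∂area = (k + 2) / (2 * (k + 1)) := by
  rw [integral_zonal']
  simp only [peak, eval_mul, eval_C, eval_pow, eval_sub, eval_one, eval_X,
    intervalIntegral.integral_const_mul, integral_one_sub_pow]
  have := Real.pi_ne_zero
  field_simp
  ring

lemma integral_peak_mul_hav (k : ℕ) (x : S2) :
    ∫ y : S2, (peak k).eval (hav x y) * hav x y ∂area = 1 / (2 * (k + 1)) := by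
  have h1 := (isZonalDensity_peak k).mass x
  have h2 := integral_peak k x
  have h3 : ∀ y : S2, (peak k).eval (hav x y) * hav x y = (peak k).eval (hav x y)
      - 1 / 2 * ((peak k).eval (hav x y) * (2 * (1 - hav x y))) := fun y => by ring
  simp only [h3]
  rw [integral_sub, integral_const_mul, h1, h2]
  · field_simp; ring
  all_goals exact continuous_integrable (by fun_prop)

lemma hav_pos {x y : S2} (h : x ≠ y) : 0 < hav x y := by
  refine (hav_nonneg x y).lt_of_ne fun h0 => h ?_
  have h1 : ⟪(x : E3), (y : E3)⟫ = 1 := by unfold hav at h0; linarith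
  exact Subtype.ext ((inner_eq_one_iff_of_norm_eq_one (by simp) (by simp)).1 h1)

/-- A continuous function vanishing at `x` is bounded by `ε + C hav x y`. -/
lemma exists_le_add_hav {G : S2 → ℝ} (hG : Continuous G) {x : S2} (hx : G x = 0) {ε : ℝ}
    (hε : 0 < ε) : ∃ C, ∀ y : S2, G y ≤ ε + C * hav x y := by
  have hK : IsCompact {y | ε ≤ G y} := (isClosed_le continuous_const hG).isCompact
  have hpos : ∀ y ∈ {y | ε ≤ G y}, 0 < hav x y := fun y hy => hav_pos fun h => by
    subst h
    have : ε ≤ G x := hy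
    linarith
  have hc : ContinuousOn (fun y : S2 => G y / hav x y) {y | ε ≤ G y} :=
    hG.continuousOn.div (by fun_prop) fun y hy => (hpos y hy).ne'
  obtain ⟨C, hC⟩ := hK.exists_bound_of_continuousOn hc
  refine ⟨max C 0, fun y => ?_⟩
  by_cases hy : ε ≤ G y
  · have h1 := (le_abs_self _).trans (hC y hy)
    rw [div_le_iff₀ (hpos y hy)] at h1
    have h2 : C * hav x y ≤ max C 0 * hav x y :=
      mul_le_mul_of_nonneg_right (le_max_left _ _) (hav_nonneg x y)
    linarith
  · have := mul_nonneg (le_max_right C 0) (hav_nonneg x y)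
    linarith

/-- The operators `op (peak k)` are an approximate identity: pointwise convergence. -/
lemma tendsto_op_peak {u : S2 → E3} (hu : Continuous u) {x : S2} (hux : ⟪(x : E3), u x⟫ = 0) :
    Filter.Tendsto (fun k => op (peak k) u x) Filter.atTop (nhds (u x)) := by
  rw [tendsto_iff_norm_sub_tendsto_zero, Metric.tendsto_atTop]
  intro ε hε
  set G : S2 → ℝ := fun y => ‖ker x y (u y) - (2 * (1 - hav x y)) • u x‖ with hGdef
  have hG : Continuous G := by fun_prop
  have hGx : G x = 0 := by
    simp only [hGdef, ker, hav_self, inner_self_sphere, real_inner_comm (x : E3), hux]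
    norm_num
  obtain ⟨C, hC⟩ := exists_le_add_hav hG hGx (half_pos hε)
  obtain ⟨N, hN⟩ := exists_nat_gt (C / ε)
  refine ⟨N, fun k hk => ?_⟩
  have hu1 := continuous_integrable hu
  have hdiff : op (peak k) u x - u x = ∫ y, (peak k).eval (hav x y) •
      (ker x y (u y) - (2 * (1 - hav x y)) • u x) ∂area := by
    simp only [smul_sub, smul_smul]
    rw [integral_sub (integrable_op hu1 x) (continuous_integrable (by fun_prop)),
      integral_smul_const, (isZonalDensity_peak k).mass, one_smul, op]
  have h1 : ‖op (peak k) u x - u x‖ ≤ ∫ y, ((ε / 2) * (peak k).eval (hav x y)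
      + C * ((peak k).eval (hav x y) * hav x y)) ∂area := by
    rw [hdiff]
    refine norm_integral_le_of_norm_le (continuous_integrable (by fun_prop))
      (Filter.Eventually.of_forall fun y => ?_)
    rw [norm_smul, Real.norm_eq_abs, abs_of_nonneg ((isZonalDensity_peak k).eval_nonneg x y)]
    calc (peak k).eval (hav x y) * G y ≤ (peak k).eval (hav x y) * (ε / 2 + C * hav x y) :=
          mul_le_mul_of_nonneg_left (hC y) ((isZonalDensity_peak k).eval_nonneg x y)
      _ = _ := by ring
  rw [integral_add, integral_const_mul, integral_const_mul, integral_peak,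
    integral_peak_mul_hav] at h1
  rotate_left
  · exact continuous_integrable (by fun_prop)
  · exact continuous_integrable (by fun_prop)
  have h2 : C < (k + 1) * ε := by
    rw [div_lt_iff₀ hε] at hN
    have : (N : ℝ) ≤ k := by exact_mod_cast hk
    nlinarith
  have hk0 : (0 : ℝ) < k + 1 := by positivity
  rw [dist_zero_right, norm_norm]
  refine h1.trans_lt ?_
  have h3 : ε / 2 * ((k + 2) / (2 * (k + 1))) + C * (1 / (2 * ((k : ℝ) + 1)))
      = (ε * (k + 2) + 2 * C) / (4 * (k + 1)) := by field_simp; ring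
  rw [h3, div_lt_iff₀ (by positivity)]
  nlinarith

/-- The orthogonal projection onto the tangent plane at `s`. -/
noncomputable def tproj (v : E3) (s : S2) : E3 := v - ⟪(s : E3), v⟫ • (s : E3)

lemma inner_tproj (v : E3) (s : S2) : ⟪(s : E3), tproj v s⟫ = 0 := by
  rw [tproj, inner_sub_right, inner_smul_right, inner_self_sphere]; ring

lemma norm_tproj_le (v : E3) (s : S2) : ‖tproj v s‖ ≤ ‖v‖ := by
  rw [← sq_le_sq₀ (norm_nonneg _) (norm_nonneg _), ← real_inner_self_eq_norm_sq,
    ← real_inner_self_eq_norm_sq]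
  have h : ⟪tproj v s, tproj v s⟫ = ⟪v, v⟫ - ⟪(s : E3), v⟫ ^ 2 := by
    simp only [tproj, inner_sub_left, inner_sub_right, real_inner_smul_left, inner_smul_right,
      inner_self_sphere, real_inner_comm (s : E3) v]
    ring
  rw [h]; nlinarith [sq_nonneg ⟪(s : E3), v⟫]

lemma exists_continuous_tangent {u : S2 → E3} (hu : MemLp u 2 area) (hut : IsTangent u)
    {ε : ℝ≥0∞} (hε : ε ≠ 0) :
    ∃ c : S2 → E3, Continuous c ∧ (∀ s : S2, ⟪(s : E3), c s⟫ = 0) ∧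
      eLpNorm (u - c) 2 area ≤ ε := by
  obtain ⟨g, hg, -⟩ := hu.exists_boundedContinuous_eLpNorm_sub_le (by norm_num) hε
  refine ⟨fun s => tproj (g s) s, ?_, fun s => inner_tproj _ s, ?_⟩
  · have := g.continuous
    unfold tproj
    fun_prop
  · refine (eLpNorm_mono_ae (hut.mono fun s hs => ?_)).trans hg
    have h : (u - fun s => tproj (g s) s) s = tproj ((u - g) s) s := by
      simp only [Pi.sub_apply, tproj, inner_sub_right, hs]
      module
    rw [h]
    exact norm_tproj_le _ s

lemma tendsto_eLpNorm_op_peak_continuous {c : S2 → E3} (hc : Continuous c)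
    (hct : ∀ s : S2, ⟪(s : E3), c s⟫ = 0) :
    Filter.Tendsto (fun k => eLpNorm (op (peak k) c - c) 2 area) Filter.atTop (nhds 0) := by
  obtain ⟨M, hM⟩ := isCompact_univ.exists_bound_of_continuousOn hc.continuousOn
  have hc1 := continuous_integrable hc
  have hbound : ∀ k x, ‖op (peak k) c x - c x‖ ≤ 2 * M := fun k x => by
    have h0 := (norm_nonneg _).trans (hM x (Set.mem_univ _))
    have h1 : ‖op (peak k) c x‖ ^ 2 ≤ M ^ 2 := by
      refine (normSq_op_le (isZonalDensity_peak k) (continuous_memLp hc 2)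
        (Filter.Eventually.of_forall hct) x).trans ?_
      calc ∫ y : S2, (peak k).eval (hav x y) * (2 * (1 - hav x y)) * ‖c y‖ ^ 2 ∂area
          ≤ ∫ y : S2, (peak k).eval (hav x y) * (2 * (1 - hav x y)) * M ^ 2 ∂area := by
            refine integral_mono (continuous_integrable (by fun_prop))
              (continuous_integrable (by fun_prop)) fun y => ?_
            have h3 := (isZonalDensity_peak k).eval_nonneg x y
            have h4 : 0 ≤ 1 - hav x y := by linarith [hav_le_one x y]
            have := hM y (Set.mem_univ _)
            simp only
            gcongr
        _ = M ^ 2 := by rw [integral_mul_const, (isZonalDensity_peak k).mass, one_mul]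
    have h2 := abs_le_of_sq_le_sq h1 h0
    calc ‖op (peak k) c x - c x‖ ≤ ‖op (peak k) c x‖ + ‖c x‖ := norm_sub_le _ _
      _ ≤ 2 * M := by linarith [(le_abs_self _).trans h2, hM x (Set.mem_univ _)]
  have hlim : Filter.Tendsto (fun k => ∫ x, ‖op (peak k) c x - c x‖ ^ 2 ∂area)
      Filter.atTop (nhds 0) := by
    have := tendsto_integral_of_dominated_convergence (μ := area)
      (F := fun k x => ‖op (peak k) c x - c x‖ ^ 2) (f := fun _ => (0 : ℝ))
      (bound := fun _ => (2 * M) ^ 2)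
      (fun k => ((((continuous_op hc1).sub hc).norm.pow 2).aestronglyMeasurable))
      (integrable_const _)
      (fun k => Filter.Eventually.of_forall fun x => by
        rw [Real.norm_eq_abs, abs_of_nonneg (sq_nonneg _)]
        exact pow_le_pow_left₀ (norm_nonneg _) (hbound k x) 2)
      (Filter.Eventually.of_forall fun x => by
        have h := (tendsto_iff_norm_sub_tendsto_zero.1 (tendsto_op_peak hc (hct x))).pow 2
        simpa using h)
    simpa using this
  have hsq : ∀ k, eLpNorm (op (peak k) c - c) 2 area
      = (ENNReal.ofReal (∫ x, ‖op (peak k) c x - c x‖ ^ 2 ∂area)) ^ (1 / 2 : ℝ) := fun k => by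
    have h := eLpNorm_two_sq (continuous_memLp ((continuous_op (q := peak k) hc1).sub hc) 2)
    have h' : ENNReal.ofReal (∫ x, ‖op (peak k) c x - c x‖ ^ 2 ∂area)
        = eLpNorm (op (peak k) c - c) 2 area ^ 2 := h.symm
    rw [h', ← ENNReal.rpow_natCast, ← ENNReal.rpow_mul]
    norm_num
  simp only [hsq]
  have h := (ENNReal.continuous_rpow_const (y := (1 / 2 : ℝ))).tendsto 0
  rw [ENNReal.zero_rpow_of_pos (by norm_num)] at h
  refine h.comp ?_
  simpa using ENNReal.tendsto_ofReal hlim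

/-- The operators `op (peak k)` are an approximate identity in `L₂`. -/
theorem tendsto_eLpNorm_op_peak {u : S2 → E3} (hu : MemLp u 2 area) (hut : IsTangent u) :
    Filter.Tendsto (fun k => eLpNorm (op (peak k) u - u) 2 area) Filter.atTop (nhds 0) := by
  rw [ENNReal.tendsto_nhds_zero]
  intro ε hε
  have hε3 : ε / 3 ≠ 0 := by
    simpa [ENNReal.div_eq_zero_iff] using hε.ne'
  obtain ⟨c, hc, hct, hcu⟩ := exists_continuous_tangent hu hut hε3
  have hcL := continuous_memLp hc 2
  have hu1 := hu.integrable one_le_two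
  have hc1 := continuous_integrable hc
  filter_upwards [(ENNReal.tendsto_nhds_zero.1 (tendsto_eLpNorm_op_peak_continuous hc hct))
    (ε / 3) (pos_iff_ne_zero.2 hε3)] with k hk
  have hsplit : op (peak k) u - u = (op (peak k) (u - c) + (op (peak k) c - c)) + (c - u) := by
    rw [op_sub hu1 hc1]; abel
  have hcut : IsTangent (u - c) := hut.mono fun s hs => by
    rw [Pi.sub_apply, inner_sub_right, hs, hct, sub_zero]
  have m1 : AEStronglyMeasurable (op (peak k) (u - c)) area :=
    (continuous_op (hu1.sub hc1)).aestronglyMeasurable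
  have m2 : AEStronglyMeasurable (op (peak k) c - c) area :=
    ((continuous_op hc1).sub hc).aestronglyMeasurable
  rw [hsplit]
  calc _ ≤ eLpNorm (op (peak k) (u - c) + (op (peak k) c - c)) 2 area
          + eLpNorm (c - u) 2 area :=
        eLpNorm_add_le (m1.add m2) (hc.aestronglyMeasurable.sub hu.1) one_le_two
    _ ≤ (eLpNorm (op (peak k) (u - c)) 2 area + eLpNorm (op (peak k) c - c) 2 area)
          + eLpNorm (c - u) 2 area := by
        gcongr
        exact eLpNorm_add_le m1 m2 one_le_two
    _ ≤ (ε / 3 + ε / 3) + ε / 3 := by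
        gcongr
        · exact (eLpNorm_op_le (isZonalDensity_peak k) (hu.sub hcL) hcut).trans hcu
        · rw [← eLpNorm_neg, neg_sub]; exact hcu
    _ = ε := by rw [ENNReal.add_thirds]

/-! ### Divergence and rotation of the eigenfields -/

lemma inner_sphereGrad {φ : E3 → ℝ} {s : S2} {v : E3} (hv : ⟪(s : E3), v⟫ = 0) :
    ⟪v, sphereGrad φ s⟫ = fderiv ℝ φ s v := by
  rw [sphereGrad, inner_sub_right, inner_smul_right, real_inner_comm (s : E3) v, hv, mul_zero,
    sub_zero, gradient, real_inner_comm, InnerProductSpace.toDual_symm_apply]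

/-- The transported field `J(hav x y) ker x y e`, as a function of `x`, is a smooth tangent field
with the divergence `-λ p(hav x y) ⟨e, x⟩`. -/
lemma integral_jac_ker_grad (m : ℕ) {φ : E3 → ℝ} (hφ : ContDiff ℝ 1 φ) (y : S2) {e : E3}
    (he : ⟪(y : E3), e⟫ = 0) :
    ∫ x : S2, (jac m).eval (hav x y) * ⟪ker x y e, sphereGrad φ x⟫ ∂area
      = lam m * ∫ x : S2, φ x * ((jacPot m).eval (hav x y) * ⟪e, (x : E3)⟫) ∂area := by
  set n := cross e y with hn
  set F : ℝ[X] := 2 * (1 - X) * jac m with hF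
  have hc : Continuous φ := hφ.continuous
  have hc' : Continuous (fderiv ℝ φ) := hφ.continuous_fderiv one_ne_zero
  have hd : ∀ x : E3, HasFDerivAt φ (fderiv ℝ φ x) x := fun x =>
    ((hφ.differentiable one_ne_zero) x).hasFDerivAt
  -- the fluxes along the two rotation fields of `ker_eq_rotations`
  have h1 := integral_rotation (y : E3)
    (f := fun x : E3 => ⟪n, x⟫ * (jac m).eval (hav x y) * φ x) (by fun_prop)
  have h2 := integral_rotation n (f := fun x : E3 => F.eval (hav x y) * φ x) (by fun_prop)
  have e1 : ∀ x : S2, fderiv ℝ (fun x : E3 => ⟪n, x⟫ * (jac m).eval (hav x y) * φ x) x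
      (cross y x) = ⟪n, (x : E3)⟫ * (jac m).eval (hav x y) * fderiv ℝ φ x (cross y x)
        - ⟪e, (x : E3)⟫ * (jac m).eval (hav x y) * φ x := fun x => by
    have h := (((hasFDerivAt_inner_left n x).mul (hasFDerivAt_poly_hav (jac m) x y)).mul
      (hd x)).fderiv
    have a1 : ⟪(y : E3), cross y x⟫ = 0 := cross_self_inner _ _
    have a2 : ⟪n, cross y x⟫ = -⟪e, (x : E3)⟫ := by
      rw [hn, ← inner_cross_left, cross_cross_right, inner_sub_left, real_inner_smul_left,
        real_inner_smul_left, inner_self_sphere, real_inner_comm, he]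
      ring
    erw [h]
    simp [a1, a2]
    ring
  have e2 : ∀ x : S2, fderiv ℝ (fun x : E3 => F.eval (hav x y) * φ x) x (cross n x)
      = F.eval (hav x y) * fderiv ℝ φ x (cross n x)
        - 1 / 2 * F.derivative.eval (hav x y) * ⟪e, (x : E3)⟫ * φ x := fun x => by
    have h := ((hasFDerivAt_poly_hav F x y).mul (hd x)).fderiv
    have a1 : ⟪(y : E3), cross n x⟫ = ⟪e, (x : E3)⟫ := by
      rw [hn, cross_cross_right, inner_sub_right, inner_smul_right, inner_smul_right,
        inner_self_sphere, he]
      ring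
    erw [h]
    simp [a1]
    ring
  simp only [e1] at h1
  simp only [e2] at h2
  have h3 := congrArg₂ (· - ·) h1 h2
  simp only [sub_zero] at h3
  rw [← integral_sub (continuous_integrable (by fun_prop)) (continuous_integrable (by fun_prop))]
    at h3
  have hpt : ∀ x : S2, (jac m).eval (hav x y) * ⟪ker x y e, sphereGrad φ x⟫
      = (⟪n, (x : E3)⟫ * (jac m).eval (hav x y) * fderiv ℝ φ x (cross y x)
          - ⟪e, (x : E3)⟫ * (jac m).eval (hav x y) * φ x
        - (F.eval (hav x y) * fderiv ℝ φ x (cross n x)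
          - 1 / 2 * F.derivative.eval (hav x y) * ⟪e, (x : E3)⟫ * φ x))
        + lam m * (φ x * ((jacPot m).eval (hav x y) * ⟪e, (x : E3)⟫)) := fun x => by
    rw [inner_sphereGrad (inner_ker_left (inner_self_sphere x)),
      ker_eq_rotations (inner_self_sphere x) (inner_self_sphere y) he, map_sub, map_smul, map_smul,
      one_add_inner_eq_hav]
    have hp := congrArg (eval (hav x y)) (lam_jacPot m)
    simp only [eval_mul, eval_C, eval_add, eval_sub, eval_X, eval_ofNat] at hp
    simp only [hF, derivative_mul, derivative_sub, derivative_one, derivative_X, derivative_ofNat,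
      eval_add, eval_mul, eval_sub, eval_one, eval_X, eval_ofNat, eval_zero, smul_eq_mul]
    linear_combination (-φ x * ⟪e, (x : E3)⟫) * hp
  simp only [hpt]
  rw [integral_add (continuous_integrable (by fun_prop)) (continuous_integrable (by fun_prop)), h3,
    zero_add, integral_const_mul]

/-- The scalar potential `∫ p(hav x y) ⟨v y, x⟩ dS(y)` of a tangent field. -/
noncomputable def pot (m : ℕ) (v : S2 → E3) (x : S2) : ℝ :=
  ∫ y, (jacPot m).eval (hav x y) * ⟪v y, (x : E3)⟫ ∂area

lemma abs_inner_sphere_le (v : E3) (x : S2) : |⟪v, (x : E3)⟫| ≤ ‖v‖ := by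
  simpa using abs_real_inner_le_norm v (x : E3)

lemma integrable_pot {q : ℝ[X]} {v : S2 → E3} (hv : Integrable v area) (x : S2) :
    Integrable (fun y : S2 => q.eval (hav x y) * ⟪v y, (x : E3)⟫) area := by
  obtain ⟨C, hC0, hC⟩ := exists_bound_eval q
  refine (hv.inner_const (𝕜 := ℝ) (x : E3)).bdd_mul (c := C)
    (Continuous.aestronglyMeasurable (by fun_prop)) (Filter.Eventually.of_forall fun y => hC x y)

lemma continuous_pot (m : ℕ) {v : S2 → E3} (hv : Integrable v area) : Continuous (pot m v) := by
  obtain ⟨C, hC0, hC⟩ := exists_bound_eval (jacPot m)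
  refine continuous_of_dominated (bound := fun y => C * ‖v y‖)
    (fun x => (integrable_pot hv x).aestronglyMeasurable)
    (fun x => Filter.Eventually.of_forall fun y => ?_) (hv.norm.const_mul C)
    (Filter.Eventually.of_forall fun y => by fun_prop)
  rw [norm_mul]
  exact mul_le_mul (hC x y) (abs_inner_sphere_le _ _) (norm_nonneg _) hC0

/-- The measurability of the integrands of `pot` on the product of two spheres. -/
lemma aestronglyMeasurable_pot (q : ℝ[X]) {v : S2 → E3} (hv : AEStronglyMeasurable v area) :
    AEStronglyMeasurable (fun p : S2 × S2 => q.eval (hav p.1 p.2) * ⟪v p.2, (p.1 : E3)⟫)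
      (area.prod area) := by
  have h1 : AEStronglyMeasurable (fun p : S2 × S2 => q.eval (hav p.1 p.2)) (area.prod area) :=
    Continuous.aestronglyMeasurable (by fun_prop)
  have h2 : AEStronglyMeasurable (fun p : S2 × S2 => (p.1 : E3)) (area.prod area) :=
    Continuous.aestronglyMeasurable (by fun_prop)
  have h3 : AEStronglyMeasurable (fun p : S2 × S2 => ⟪v p.2, (p.1 : E3)⟫) (area.prod area) :=
    hv.comp_snd.inner h2
  exact h1.mul h3

lemma integral_mul_pot (m : ℕ) {v : S2 → E3} (hv : Integrable v area) {g : S2 → ℝ}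
    (hg : Integrable g area) : ∫ x, g x * pot m v x ∂area
      = ∫ y, ∫ x, g x * ((jacPot m).eval (hav x y) * ⟪v y, (x : E3)⟫) ∂area ∂area := by
  obtain ⟨C, hC0, hC⟩ := exists_bound_eval (jacPot m)
  simp only [pot, ← integral_const_mul]
  refine integral_swap_of_le C ?_ hg.norm hv.norm fun x y => ?_
  · exact hg.aestronglyMeasurable.comp_fst.mul (aestronglyMeasurable_pot _ hv.aestronglyMeasurable)
  · rw [abs_mul, abs_mul]
    calc |g x| * (|(jacPot m).eval (hav x y)| * |⟪v y, (x : E3)⟫|) ≤ |g x| * (C * ‖v y‖) := by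
          gcongr
          · exact hC x y
          · exact abs_inner_sphere_le _ _
      _ = C * (‖g x‖ * ‖v y‖) := by rw [Real.norm_eq_abs]; ring

lemma continuous_sphereGrad {φ : E3 → ℝ} (hφ : ContDiff ℝ 1 φ) :
    Continuous fun s : S2 => sphereGrad φ s := by
  have h : Continuous fun s : S2 => gradient φ s := by
    unfold gradient
    have := (hφ.continuous_fderiv one_ne_zero).comp
      (continuous_subtype_val (p := (· ∈ Metric.sphere (0 : E3) 1)))
    exact (InnerProductSpace.toDual ℝ E3).symm.continuous.comp this
  unfold sphereGrad
  fun_prop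

/-- The eigenfield `op (jac m) v` has the divergence `-λ pot m v`. -/
lemma isWeakDiv_op (m : ℕ) {v : S2 → E3} (hv : Integrable v area) (hvt : IsTangent v) :
    IsWeakDiv (op (jac m) v) (fun x => -(lam m * pot m v x)) := by
  have hc := continuous_pot m hv
  refine ⟨continuous_memLp (by fun_prop) 2, fun φ hφ => ?_⟩
  have hφ1 : ContDiff ℝ 1 φ := hφ.of_le (by exact_mod_cast le_top)
  have hφc : Continuous φ := hφ.continuous
  have hG := continuous_sphereGrad hφ1
  obtain ⟨C, hC0, hC⟩ := exists_bound_eval (jac m)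
  obtain ⟨M, hM⟩ := isCompact_univ.exists_bound_of_continuousOn hG.continuousOn
  have h1 : ∫ x, ⟪op (jac m) v x, sphereGrad φ x⟫ ∂area
      = ∫ y, ∫ x, (jac m).eval (hav x y) * ⟪ker x y (v y), sphereGrad φ x⟫ ∂area ∂area := by
    simp only [inner_op hv]
    refine integral_swap_of_le (C * 4 * M) ?_ (integrable_const (1 : ℝ)) hv.norm fun x y => ?_
    · have h1 : AEStronglyMeasurable (fun p : S2 × S2 => (jac m).eval (hav p.1 p.2))
          (area.prod area) := Continuous.aestronglyMeasurable (by fun_prop)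
      have h2 : AEStronglyMeasurable (fun p : S2 × S2 => ker p.1 p.2 (v p.2)) (area.prod area) :=
        aestronglyMeasurable_ker (continuous_subtype_val.comp continuous_fst).aestronglyMeasurable
          (continuous_subtype_val.comp continuous_snd).aestronglyMeasurable
          hv.aestronglyMeasurable.comp_snd
      have h3 : AEStronglyMeasurable (fun p : S2 × S2 => ⟪ker p.1 p.2 (v p.2), sphereGrad φ p.1⟫)
          (area.prod area) := h2.inner hG.aestronglyMeasurable.comp_fst
      exact h1.mul h3
    · rw [abs_mul]
      calc |(jac m).eval (hav x y)| * |⟪ker x y (v y), sphereGrad φ x⟫|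
          ≤ C * (4 * ‖v y‖ * M) := by
            refine mul_le_mul (hC x y) ((abs_real_inner_le_norm _ _).trans ?_) (abs_nonneg _) hC0
            exact mul_le_mul (norm_ker_le x y _) (hM x (Set.mem_univ _)) (norm_nonneg _)
              (by positivity)
        _ = C * 4 * M * (1 * ‖v y‖) := by ring
  have h2 : ∫ y, ∫ x, (jac m).eval (hav x y) * ⟪ker x y (v y), sphereGrad φ x⟫ ∂area ∂area
      = lam m * ∫ x : S2, φ x * pot m v x ∂area := by
    rw [integral_mul_pot m hv (continuous_integrable (by fun_prop)), ← integral_const_mul]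
    exact integral_congr_ae (hvt.mono fun y hy => integral_jac_ker_grad m hφ1 y hy)
  rw [h1, h2, ← integral_const_mul, ← integral_neg]
  congr 1; ext1 x; ring

/-! ### Zonal operators and fields with weak divergence and rotation -/

lemma aestronglyMeasurable_perp {u : S2 → E3} (hu : AEStronglyMeasurable u area) :
    AEStronglyMeasurable (perp u) area := by
  have h : AEStronglyMeasurable (fun s : S2 => (s : E3)) area :=
    continuous_subtype_val.aestronglyMeasurable
  exact Continuous.comp_aestronglyMeasurable₂ (g := cross) continuous_cross hu h

lemma memLp_perp {u : S2 → E3} (hu : MemLp u 2 area) : MemLp (perp u) 2 area :=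
  hu.of_le (aestronglyMeasurable_perp hu.1)
    (Filter.Eventually.of_forall fun s => norm_cross_le (u s) s)

lemma integrable_inner_of_memLp {F : Type*} [NormedAddCommGroup F] [InnerProductSpace ℝ F]
    {f g : S2 → F} (hf : MemLp f 2 area) (hg : MemLp g 2 area) :
    Integrable (fun s => ⟪f s, g s⟫) area := by
  refine ((integrable_normSq hf).add (integrable_normSq hg)).mono' (hf.1.inner hg.1)
    (Filter.Eventually.of_forall fun s => (norm_inner_le_norm _ _).trans ?_)
  simp only [Pi.add_apply]
  nlinarith [sq_nonneg (‖f s‖ - ‖g s‖), sq_nonneg ‖f s‖, sq_nonneg ‖g s‖]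

lemma isTangent_perp (u : S2 → E3) : IsTangent (perp u) :=
  Filter.Eventually.of_forall fun s => cross_inner_self (u s) s

lemma perp_op (q : ℝ[X]) {v : S2 → E3} (hv : MemLp v 2 area) (hvt : IsTangent v) :
    perp (op q v) = op q (perp v) := by
  have hv1 := hv.integrable one_le_two
  ext1 x
  refine ext_inner_right ℝ fun e => ?_
  rw [perp_apply, inner_cross_left, inner_op hv1, inner_op ((memLp_perp hv).integrable one_le_two)]
  refine integral_congr_ae (hvt.mono fun y hy => ?_)
  simp only
  rw [← inner_cross_left, cross_ker (inner_self_sphere x) (inner_self_sphere y) hy, perp_apply]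

/-- Weak form of the statement that, as a function of `y`, the transported field is the sum of a
gradient and a rotated gradient with the potentials `p(hav y x) ⟨e, y⟩` and
`p(hav y x) ⟨e × x, y⟩`. -/
lemma jac_inner_ker (m : ℕ) {x y : S2} {e u : E3} (he : ⟪(x : E3), e⟫ = 0)
    (hu : ⟪(y : E3), u⟫ = 0) :
    (jac m).eval (hav y x) * ⟪u, ker y x e⟫
      = ⟪u, sphereGrad (fun z => (jacPot m).eval (hav z x) * ⟪e, z⟫) y⟫
        + ⟪cross u y, sphereGrad (fun z => (jacPot m).eval (hav z x) * ⟪cross e x, z⟫) y⟫ := by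
  have hd : ∀ a : E3, fderiv ℝ (fun z => (jacPot m).eval (hav z x) * ⟪a, z⟫) y
      = _ := fun a =>
    ((hasFDerivAt_poly_hav (jacPot m) y x).mul (hasFDerivAt_inner_left a y)).fderiv
  rw [inner_sphereGrad hu, inner_sphereGrad (cross_inner_self u y)]
  erw [hd, hd]
  have a1 : ⟪cross e x, cross u y⟫
      = ⟪e, u⟫ * ⟪(y : E3), (x : E3)⟫ - ⟪e, (y : E3)⟫ * ⟪(x : E3), u⟫ := by
    simp only [inner_eq, cross_zero, cross_one, cross_two]; ring
  have a2 : ⟪cross e x, (y : E3)⟫ * ⟪(x : E3), cross u y⟫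
      = -((1 - ⟪(y : E3), (x : E3)⟫ ^ 2) * ⟪e, u⟫
        + ⟪(y : E3), (x : E3)⟫ * ⟪e, (y : E3)⟫ * ⟪(x : E3), u⟫) := by
    have h := congrArg (fun w => ⟪w, u⟫)
      (inner_cross_smul_cross (inner_self_sphere y) (inner_self_sphere x) he)
    simp only [inner_add_left, inner_sub_left, real_inner_smul_left, hu] at h
    have h2 : ⟪cross (x : E3) y, u⟫ = -⟪(x : E3), cross u y⟫ := by
      simp only [inner_eq, cross_zero, cross_one, cross_two]; ring
    rw [h2] at h
    linarith
  have hk : ⟪u, ker y x e⟫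
      = (1 + ⟪(y : E3), (x : E3)⟫) * ⟪e, u⟫ - ⟪e, (y : E3)⟫ * ⟪(x : E3), u⟫ := by
    rw [real_inner_comm, inner_ker hu]
  have hJ := congrArg (eval (hav y x)) (jac_eq m)
  simp only [eval_add, eval_mul, eval_X] at hJ
  have ht : ⟪(y : E3), (x : E3)⟫ = 1 - 2 * hav y x := by unfold hav; ring
  rw [hk, hJ]
  simp [a1]
  rw [ht] at a2 ⊢
  linear_combination (1 / 2 * (derivative (jacPot m)).eval (hav y x)) * a2

/-- The zonal operator on a field with weak divergence `d` and weak rotation `r`. -/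
lemma integral_inner_op_jac (m : ℕ) {u v : S2 → E3} {d r : S2 → ℝ} (hu : MemLp u 2 area)
    (hut : IsTangent u) (hv : MemLp v 2 area) (hvt : IsTangent v) (hd : IsWeakDiv u d)
    (hr : IsWeakDiv (perp u) r) :
    ∫ x, ⟪op (jac m) u x, v x⟫ ∂area
      = -(∫ x, d x * pot m v x ∂area + ∫ x, r x * pot m (perp v) x ∂area) := by
  have hu1 := hu.integrable one_le_two
  have hv1 := hv.integrable one_le_two
  have hpv1 := (memLp_perp hv).integrable one_le_two
  have hd1 := hd.1.integrable one_le_two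
  have hr1 := hr.1.integrable one_le_two
  obtain ⟨C, hC0, hC⟩ := exists_bound_eval (jacPot m)
  have hprod : ∀ {g : S2 → ℝ} {w : S2 → E3}, Integrable g area → Integrable w area →
      Integrable (fun p : S2 × S2 => g p.1 * ((jacPot m).eval (hav p.1 p.2) * ⟪w p.2, (p.1 : E3)⟫))
        (area.prod area) := fun {g w} hg hw => by
    refine ((hg.norm.mul_prod hw.norm).const_mul C).mono'
      (hg.aestronglyMeasurable.comp_fst.mul (aestronglyMeasurable_pot _ hw.aestronglyMeasurable))
      (Filter.Eventually.of_forall fun p => ?_)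
    rw [norm_mul, norm_mul]
    calc ‖g p.1‖ * (‖(jacPot m).eval (hav p.1 p.2)‖ * ‖⟪w p.2, (p.1 : E3)⟫‖)
        ≤ ‖g p.1‖ * (C * ‖w p.2‖) := by
          gcongr
          · exact hC p.1 p.2
          · exact abs_inner_sphere_le _ _
      _ = C * (‖g p.1‖ * ‖w p.2‖) := by ring
  rw [integral_mul_pot m hv1 hd1, integral_mul_pot m hpv1 hr1,
    ← integral_add (hprod hd1 hv1).integral_prod_right (hprod hr1 hpv1).integral_prod_right,
    ← integral_neg]
  refine integral_congr_ae (hvt.mono fun x hx => ?_)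
  simp only
  have h1 := hd.2 (fun z => (jacPot m).eval (hav z x) * ⟪v x, z⟫) (by fun_prop)
  have h2 := hr.2 (fun z => (jacPot m).eval (hav z x) * ⟪perp v x, z⟫) (by fun_prop)
  rw [h1, h2, ← neg_add, neg_neg, inner_op hu1]
  have hgrad : ∀ a : E3, Continuous fun y : S2 =>
      sphereGrad (fun z => (jacPot m).eval (hav z x) * ⟪a, z⟫) y := fun a =>
    continuous_sphereGrad (by fun_prop)
  have hint : ∀ (a : E3) {w : S2 → E3}, MemLp w 2 area → Integrable (fun y : S2 =>
      ⟪w y, sphereGrad (fun z => (jacPot m).eval (hav z x) * ⟪a, z⟫) y⟫) area := fun a {w} hw =>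
    integrable_inner_of_memLp hw (continuous_memLp (hgrad a) 2)
  rw [← integral_add (hint _ hu) (hint _ (memLp_perp hu))]
  refine integral_congr_ae (hut.mono fun y hy => ?_)
  simp only
  rw [inner_ker_symm hx hy, hav_comm, jac_inner_ker m hx hy, perp_apply, perp_apply]

/-! ### The spectral projections -/

lemma memLp_op (q : ℝ[X]) {u : S2 → E3} (hu : MemLp u 2 area) : MemLp (op q u) 2 area :=
  continuous_memLp (continuous_op (hu.integrable one_le_two)) 2

lemma isTangent_op' (q : ℝ[X]) {u : S2 → E3} (hu : MemLp u 2 area) : IsTangent (op q u) :=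
  isTangent_op (hu.integrable one_le_two)

/-- The eigenfields have the divergence `-λ pot` and the rotation `-λ pot ∘ perp`, so that the
composition of two operators is a symmetric form in the potentials, up to the eigenvalue. -/
lemma integral_inner_op_op (m n : ℕ) {w v : S2 → E3} (hw : MemLp w 2 area) (hwt : IsTangent w)
    (hv : MemLp v 2 area) (hvt : IsTangent v) :
    ∫ x, ⟪op (jac n) (op (jac m) w) x, v x⟫ ∂area
      = lam m * (∫ x, pot m w x * pot n v x ∂area
        + ∫ x, pot m (perp w) x * pot n (perp v) x ∂area) := by
  have hr := isWeakDiv_op m ((memLp_perp hw).integrable one_le_two) (isTangent_perp w)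
  rw [← perp_op (jac m) hw hwt] at hr
  rw [integral_inner_op_jac n (memLp_op _ hw) (isTangent_op' _ hw) hv hvt
    (isWeakDiv_op m (hw.integrable one_le_two) hwt) hr]
  simp only [neg_mul, integral_neg, mul_assoc, integral_const_mul]
  ring

lemma op_jac_op_jac_ne {m n : ℕ} (hmn : m ≠ n) {w : S2 → E3} (hw : MemLp w 2 area)
    (hwt : IsTangent w) : op (jac n) (op (jac m) w) = 0 := by
  set v := op (jac n) (op (jac m) w) with hvdef
  have hm := memLp_op (jac m) hw
  have hv : MemLp v 2 area := memLp_op _ hm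
  have hvt : IsTangent v := isTangent_op' _ hm
  have h1 := integral_inner_op_op m n hw hwt hv hvt
  have h2 := integral_inner_op_op n m hv hvt hw hwt
  have h3 : ∫ x, ⟪op (jac m) (op (jac n) v) x, w x⟫ ∂area
      = ∫ x, ⟪op (jac n) (op (jac m) w) x, v x⟫ ∂area := by
    have i1 := hv.integrable one_le_two
    have i2 := hw.integrable one_le_two
    rw [integral_inner_op_comm (jac m) ((memLp_op _ hv).integrable one_le_two) i2
      (isTangent_op' _ hv) hwt, integral_inner_op_comm (jac n) i1
      ((memLp_op _ hw).integrable one_le_two) hvt (isTangent_op' _ hw)]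
  simp only [mul_comm (pot n _ _)] at h2
  rw [h3, h1] at h2
  have h4 : (lam m - lam n) * (∫ x, pot m w x * pot n v x ∂area
        + ∫ x, pot m (perp w) x * pot n (perp v) x ∂area) = 0 := by linarith
  have h5 : lam m - lam n ≠ 0 := sub_ne_zero.2 fun h => hmn (lam_injective h)
  rw [(mul_eq_zero.1 h4).resolve_left h5, mul_zero] at h1
  have hvc : Continuous v := continuous_op (hm.integrable one_le_two)
  have h6 : ∫ x, ‖v x‖ ^ 2 ∂area = 0 := by
    simpa only [← hvdef, real_inner_self_eq_norm_sq] using h1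
  have : area.IsOpenPosMeasure := inferInstanceAs (Measure.IsOpenPosMeasure (Measure.toSphere _))
  have h7 := (integral_eq_zero_iff_of_nonneg (fun x => sq_nonneg _) (integrable_normSq hv)).1 h6
  have h8 := (Continuous.ae_eq_iff_eq area (hvc.norm.pow 2) continuous_zero).1 h7
  ext1 x
  simpa using congrFun h8 x

/-- The normalization `(2 n + 1) / (8 π)`, `n = m + 1`, of the spectral projection. -/
noncomputable def kap (m : ℕ) : ℝ := (2 * m + 3) / (8 * Real.pi)

lemma kap_pos (m : ℕ) : 0 < kap m := by unfold kap; have := Real.pi_pos; positivity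

lemma integral_pow_mul_poly (k : ℕ) (G : ℝ[X]) :
    (k + 1) * ∫ t in (0 : ℝ)..1, (1 - t) ^ k * G.eval t
      = G.eval 0 + ∫ t in (0 : ℝ)..1, (1 - t) ^ (k + 1) * (derivative G).eval t := by
  have h := integral_derivative ((1 - X) ^ (k + 1) * G)
  have h1 : derivative ((1 - X) ^ (k + 1) * G)
      = (1 - X) ^ (k + 1) * derivative G - C ((k : ℝ) + 1) * ((1 - X) ^ k * G) := by
    simp only [derivative_mul, derivative_pow, derivative_X, derivative_sub, derivative_one]
    simp
    ring
  rw [h1] at h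
  simp only [eval_sub, eval_mul, eval_pow, eval_one, eval_X, eval_C] at h
  rw [intervalIntegral.integral_sub, intervalIntegral.integral_const_mul] at h
  · simp at h; linarith
  all_goals exact Continuous.intervalIntegrable (by fun_prop) _ _

lemma tendsto_integral_pow_mul_poly (G : ℝ[X]) :
    Filter.Tendsto (fun k : ℕ => ((k : ℝ) + 1) * ∫ t in (0 : ℝ)..1, (1 - t) ^ k * G.eval t)
      Filter.atTop (nhds (G.eval 0)) := by
  obtain ⟨C, hC⟩ := (isCompact_Icc (a := (0 : ℝ)) (b := 1)).exists_bound_of_continuousOn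
    (derivative G).continuous.continuousOn
  simp only [integral_pow_mul_poly]
  rw [tendsto_iff_norm_sub_tendsto_zero]
  simp only [add_sub_cancel_left]
  have hlim : Filter.Tendsto (fun k : ℕ => C * (1 / ((k : ℝ) + 1))) Filter.atTop (nhds 0) := by
    simpa using tendsto_one_div_add_atTop_nhds_zero_nat.const_mul C
  have hC0 : 0 ≤ C := (norm_nonneg _).trans (hC 0 (by simp))
  refine squeeze_zero (fun k => norm_nonneg _) (fun k => ?_) hlim
  have h1 : ‖∫ t in (0 : ℝ)..1, (1 - t) ^ (k + 1) * (derivative G).eval t‖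
      ≤ ∫ t in (0 : ℝ)..1, (1 - t) ^ (k + 1) * C := by
    refine intervalIntegral.norm_integral_le_of_norm_le zero_le_one
      (Filter.Eventually.of_forall fun t ht => ?_)
      (Continuous.intervalIntegrable (by fun_prop) _ _)
    have h0 : 0 ≤ 1 - t := by linarith [ht.2]
    rw [norm_mul, Real.norm_of_nonneg (pow_nonneg h0 _)]
    exact mul_le_mul_of_nonneg_left (hC t ⟨ht.1.le, ht.2⟩) (pow_nonneg h0 _)
  refine h1.trans ?_
  rw [intervalIntegral.integral_mul_const, integral_one_sub_pow, mul_comm]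
  refine mul_le_mul_of_nonneg_left ?_ hC0
  apply one_div_le_one_div_of_le (by positivity)
  push_cast; linarith

lemma tendsto_wip_peak (n : ℕ) :
    Filter.Tendsto (fun k => wip (jac n) (peak k)) Filter.atTop (nhds (1 / (8 * Real.pi))) := by
  have h := ((tendsto_integral_pow_mul_poly ((1 - X) * jac n)).comp
    (Filter.tendsto_add_atTop_nat 1)).const_mul (1 / (8 * Real.pi))
  have h0 : ((1 - X) * jac n).eval 0 = 1 := by simp [eval_zero_jac]
  rw [h0, mul_one] at h
  refine h.congr fun k => ?_
  unfold wip
  simp only [Function.comp_apply, ← intervalIntegral.integral_const_mul]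
  congr 1
  ext t
  simp only [peak, eval_mul, eval_C, eval_pow, eval_sub, eval_one, eval_X]
  push_cast
  ring

lemma coeff_peak_eq_zero (k : ℕ) {j : ℕ} (hj : k + 1 ≤ j) : (peak k).coeff j = 0 := by
  refine coeff_eq_zero_of_natDegree_lt (lt_of_le_of_lt ?_ (Nat.lt_of_succ_le hj))
  unfold peak
  refine (natDegree_C_mul_le _ _).trans ((natDegree_pow_le).trans ?_)
  have : (1 - X : ℝ[X]).natDegree ≤ 1 := (natDegree_sub_le _ _).trans (by simp)
  nlinarith

/-- The approximate identity acts on eigenfields as a multiple of `op (jac n)`. -/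
lemma op_peak_op_jac {k n : ℕ} (hn : n ≤ k) {v : S2 → E3} (hv : MemLp v 2 area)
    (hvt : IsTangent v) : op (peak k) (op (jac n) v)
      = ((2 * n + 3) * wip (jac n) (peak k)) • op (jac n) (op (jac n) v) := by
  obtain ⟨b, hb⟩ := exists_jac_expansion (k + 1) (peak k) fun j hj => coeff_peak_eq_zero k hj
  have hmem : n ∈ Finset.range (k + 1) := Finset.mem_range.2 (by omega)
  have h1 : wip (jac n) (peak k) = b n / (2 * n + 3) := by
    rw [hb, wip_sum_right, Finset.sum_eq_single_of_mem n hmem fun m _ hm => by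
      rw [wip_C_mul_right, wip_jac_ne hm.symm, mul_zero], wip_C_mul_right, wip_jac_self]
    ring
  have h2 : (2 * n + 3) * wip (jac n) (peak k) = b n := by
    rw [h1]; have : (2 * n + 3 : ℝ) ≠ 0 := by positivity
    field_simp
  rw [h2, hb, op_poly_sum _ _ ((memLp_op _ hv).integrable one_le_two),
    Finset.sum_eq_single_of_mem n hmem fun m _ hm => by
      rw [op_C_mul, op_jac_op_jac_ne hm.symm hv hvt, smul_zero], op_C_mul]

/-- `kap n • op (jac n)` is idempotent. -/
lemma kap_smul_op_jac_op_jac (n : ℕ) {v : S2 → E3} (hv : MemLp v 2 area) (hvt : IsTangent v) :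
    kap n • op (jac n) (op (jac n) v) = op (jac n) v := by
  have hv1 := hv.integrable one_le_two
  ext1 x
  have h1 := tendsto_op_peak (continuous_op (q := jac n) hv1) (inner_left_op hv1 x)
  have h2 := ((tendsto_wip_peak n).const_mul (2 * (n : ℝ) + 3)).smul_const
    (op (jac n) (op (jac n) v) x)
  have h3 : (2 * (n : ℝ) + 3) * (1 / (8 * Real.pi)) = kap n := by unfold kap; ring
  rw [h3] at h2
  refine tendsto_nhds_unique (h2.congr' ?_) h1
  filter_upwards [Filter.eventually_ge_atTop n] with k hk
  rw [op_peak_op_jac hk hv hvt, Pi.smul_apply]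

/-- The orthogonal projection of tangent fields onto the eigenspace of degree `m + 1`. -/
noncomputable def proj (m : ℕ) (u : S2 → E3) : S2 → E3 := kap m • op (jac m) u

lemma continuous_proj (m : ℕ) {u : S2 → E3} (hu : MemLp u 2 area) : Continuous (proj m u) :=
  (continuous_op (hu.integrable one_le_two)).const_smul _

lemma inner_left_proj (m : ℕ) {u : S2 → E3} (hu : MemLp u 2 area) (x : S2) :
    ⟪(x : E3), proj m u x⟫ = 0 := by
  rw [proj, Pi.smul_apply, inner_smul_right, inner_left_op (hu.integrable one_le_two), mul_zero]

lemma memLp_proj (m : ℕ) {u : S2 → E3} (hu : MemLp u 2 area) : MemLp (proj m u) 2 area :=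
  continuous_memLp (continuous_proj m hu) 2

lemma isTangent_proj (m : ℕ) {u : S2 → E3} (hu : MemLp u 2 area) : IsTangent (proj m u) :=
  Filter.Eventually.of_forall (inner_left_proj m hu)

lemma proj_proj_self (m : ℕ) {u : S2 → E3} (hu : MemLp u 2 area) (hut : IsTangent u) :
    proj m (proj m u) = proj m u := by
  rw [proj, proj, op_smul, kap_smul_op_jac_op_jac m hu hut]

lemma proj_proj_ne {m n : ℕ} (h : m ≠ n) {u : S2 → E3} (hu : MemLp u 2 area)
    (hut : IsTangent u) : proj n (proj m u) = 0 := by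
  rw [proj, proj, op_smul, op_jac_op_jac_ne h hu hut, smul_zero, smul_zero]

lemma integral_inner_proj_comm (m : ℕ) {u v : S2 → E3} (hu : MemLp u 2 area)
    (hut : IsTangent u) (hv : MemLp v 2 area) (hvt : IsTangent v) :
    ∫ x, ⟪proj m u x, v x⟫ ∂area = ∫ x, ⟪u x, proj m v x⟫ ∂area := by
  simp only [proj, Pi.smul_apply, real_inner_smul_left, inner_smul_right, integral_const_mul]
  rw [integral_inner_op_comm _ (hu.integrable one_le_two) (hv.integrable one_le_two) hut hvt]

lemma integral_inner_proj_proj (m n : ℕ) {u : S2 → E3} (hu : MemLp u 2 area)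
    (hut : IsTangent u) : ∫ x, ⟪proj m u x, proj n u x⟫ ∂area
      = if m = n then ∫ x, ‖proj n u x‖ ^ 2 ∂area else 0 := by
  split_ifs with h
  · subst h; simp only [real_inner_self_eq_norm_sq]
  · rw [← integral_inner_proj_comm n (memLp_proj m hu) (isTangent_proj m hu) hu hut,
      proj_proj_ne h hu hut]
    simp

lemma integral_inner_proj_self (m : ℕ) {u : S2 → E3} (hu : MemLp u 2 area)
    (hut : IsTangent u) : ∫ x, ⟪proj m u x, u x⟫ ∂area = ∫ x, ‖proj m u x‖ ^ 2 ∂area := by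
  have h := integral_inner_proj_proj m m hu hut
  rw [if_pos rfl, ← integral_inner_proj_comm m (memLp_proj m hu) (isTangent_proj m hu) hu hut,
    proj_proj_self m hu hut] at h
  exact h

/-- Bessel's inequality for the energy: the spectral energy of `u` is bounded by the norms of the
weak divergence and rotation. -/
theorem sum_lam_mul_normSq_proj_le (N : ℕ) {u : S2 → E3} {d r : S2 → ℝ} (hu : MemLp u 2 area)
    (hut : IsTangent u) (hd : IsWeakDiv u d) (hr : IsWeakDiv (perp u) r) :
    ∑ n ∈ Finset.range N, lam n * ∫ x, ‖proj n u x‖ ^ 2 ∂area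
      ≤ ∫ x, d x ^ 2 ∂area + ∫ x, r x ^ 2 ∂area := by
  have hu1 := hu.integrable one_le_two
  have hpu1 := (memLp_perp hu).integrable one_le_two
  set S := ∑ n ∈ Finset.range N, lam n * ∫ x, ‖proj n u x‖ ^ 2 ∂area with hS
  -- the divergence and the rotation of the truncation of `u` are `-A` and `-B`
  set A : S2 → ℝ := fun x => ∑ n ∈ Finset.range N, lam n * kap n * pot n u x with hA
  set B : S2 → ℝ := fun x => ∑ n ∈ Finset.range N, lam n * kap n * pot n (perp u) x with hB
  have hAc : Continuous A := continuous_finsetSum _ fun n _ => (continuous_pot n hu1).const_mul _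
  have hBc : Continuous B := continuous_finsetSum _ fun n _ => (continuous_pot n hpu1).const_mul _
  have hAL := continuous_memLp hAc 2
  have hBL := continuous_memLp hBc 2
  have hcp : ∀ n, Continuous (pot n u) := fun n => continuous_pot n hu1
  have hcq : ∀ n, Continuous (pot n (perp u)) := fun n => continuous_pot n hpu1
  have h1 : S = -(∫ x, d x * A x ∂area + ∫ x, r x * B x ∂area) := by
    have e1 : ∀ {g : S2 → ℝ} (hg : MemLp g 2 area) (w : S2 → E3),
        (∀ n, Continuous (pot n w)) →
        ∫ x, g x * ∑ n ∈ Finset.range N, lam n * kap n * pot n w x ∂area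
          = ∑ n ∈ Finset.range N, lam n * kap n * ∫ x, g x * pot n w x ∂area :=
      fun {g} hg w hw => by
        simp only [Finset.mul_sum]
        rw [integral_finsetSum]
        · refine Finset.sum_congr rfl fun n _ => ?_
          rw [← integral_const_mul]
          congr 1; ext1 x; ring
        · intro n _
          exact hg.integrable_mul (continuous_memLp ((hw n).const_mul (lam n * kap n)) 2)
    rw [hA, hB, e1 hd.1 u hcp, e1 hr.1 (perp u) hcq, ← Finset.sum_add_distrib,
      ← Finset.sum_neg_distrib, hS]
    refine Finset.sum_congr rfl fun n _ => ?_
    rw [← integral_inner_proj_self n hu hut]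
    simp only [proj, Pi.smul_apply, real_inner_smul_left, integral_const_mul]
    rw [integral_inner_op_jac n hu hut hu hut hd hr]
    ring
  have h2 : ∫ x, A x ^ 2 ∂area + ∫ x, B x ^ 2 ∂area = S := by
    have e1 : ∀ (w : S2 → E3), (∀ n, Continuous (pot n w)) →
        ∫ x, (∑ n ∈ Finset.range N, lam n * kap n * pot n w x) ^ 2 ∂area
          = ∑ n ∈ Finset.range N, ∑ m ∈ Finset.range N,
            lam n * kap n * (lam m * kap m) * ∫ x, pot m w x * pot n w x ∂area :=
      fun w hw => by
        simp only [sq, Finset.sum_mul_sum]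
        rw [integral_finsetSum]
        · refine Finset.sum_congr rfl fun n _ => ?_
          rw [integral_finsetSum]
          · refine Finset.sum_congr rfl fun m _ => ?_
            rw [← integral_const_mul]
            congr 1; ext1 x; ring
          · intro m _
            have := hw n
            have := hw m
            exact continuous_integrable (by fun_prop)
        · intro n _
          refine continuous_integrable (continuous_finsetSum _ fun m _ => ?_)
          have := hw n
          have := hw m
          fun_prop
    rw [hA, hB, e1 u hcp, e1 (perp u) hcq, ← Finset.sum_add_distrib, hS]
    refine Finset.sum_congr rfl fun n hn => ?_
    rw [← Finset.sum_add_distrib]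
    have e2 : ∀ m ∈ Finset.range N, lam n * kap n * (lam m * kap m) *
          (∫ x, pot m u x * pot n u x ∂area) + lam n * kap n * (lam m * kap m) *
          (∫ x, pot m (perp u) x * pot n (perp u) x ∂area)
        = lam n * ∫ x, ⟪proj n (proj m u) x, u x⟫ ∂area := fun m _ => by
      have h := integral_inner_op_op m n hu hut hu hut
      simp only [proj, op_smul, Pi.smul_apply, real_inner_smul_left, integral_const_mul]
      rw [h]; ring
    rw [Finset.sum_congr rfl e2, Finset.sum_eq_single_of_mem n hn fun m _ hm => by
      rw [proj_proj_ne hm hu hut]; simp, proj_proj_self n hu hut, integral_inner_proj_self n hu hut]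
  have key : ∀ {g G : S2 → ℝ}, MemLp g 2 area → MemLp G 2 area →
      -∫ x, g x * G x ∂area ≤ 1 / 2 * ∫ x, g x ^ 2 ∂area + 1 / 2 * ∫ x, G x ^ 2 ∂area :=
    fun {g G} hg hG => by
      have i1 : Integrable (fun x => g x ^ 2) area := hg.integrable_sq
      have i2 : Integrable (fun x => G x ^ 2) area := hG.integrable_sq
      rw [← integral_neg, ← integral_const_mul, ← integral_const_mul,
        ← integral_add (i1.const_mul _) (i2.const_mul _)]
      refine integral_mono (hg.integrable_mul hG).neg ((i1.const_mul _).add (i2.const_mul _))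
        fun x => ?_
      simp only
      nlinarith [sq_nonneg (g x + G x)]
  have k1 := key hd.1 hAL
  have k2 := key hr.1 hBL
  linarith

/-! ### The spectral cutoff -/

/-- The profile of the spectral cutoff, `a² / (x² + a²)`. At the level `a` the weight `cut a λ` of
the eigenvalue `λ` selects the low frequencies, and the complementary weight is `cut λ a`. The
profile minimizes the constant, as it minimizes `f² + (1 - f)² / t²` at each `t = x / a`. -/
noncomputable def cut (a x : ℝ) : ℝ := a ^ 2 / (x ^ 2 + a ^ 2)

/-- A primitive of `x ↦ (cut a x)²`. -/
noncomputable def cutPrim (a x : ℝ) : ℝ :=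
  a ^ 2 * x / (2 * (x ^ 2 + a ^ 2)) + a / 2 * Real.arctan (x / a)

lemma hasDerivAt_cutPrim {a : ℝ} (ha : 0 < a) (x : ℝ) :
    HasDerivAt (cutPrim a) (cut a x ^ 2) x := by
  have hpos : x ^ 2 + a ^ 2 ≠ 0 := by positivity
  have h1 : HasDerivAt (fun x => a ^ 2 * x) (a ^ 2 * 1) x := (hasDerivAt_id x).const_mul _
  have h2 : HasDerivAt (fun x => 2 * (x ^ 2 + a ^ 2)) (2 * (2 * x)) x := by
    simpa using (((hasDerivAt_pow 2 x).add_const (a ^ 2)).const_mul 2)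
  have h3 : HasDerivAt (fun x => a / 2 * Real.arctan (x / a))
      (a / 2 * (1 / (1 + (x / a) ^ 2) * (1 / a))) x :=
    ((((hasDerivAt_id x).div_const a).arctan).const_mul _)
  have h := (h1.fun_div h2 (by positivity)).fun_add h3
  refine h.congr_deriv ?_
  unfold cut
  have hpos' : a ^ 2 + x ^ 2 ≠ 0 := by positivity
  have : 1 + (x / a) ^ 2 = (x ^ 2 + a ^ 2) / a ^ 2 := by field_simp; ring
  rw [this]
  field_simp
  ring

lemma continuous_cut {a : ℝ} (ha : 0 < a) : Continuous (cut a) := by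
  unfold cut
  exact continuous_const.div (by fun_prop) fun x => by positivity

lemma integral_cut_sq {a : ℝ} (ha : 0 < a) (b c : ℝ) :
    ∫ x in b..c, cut a x ^ 2 = cutPrim a c - cutPrim a b :=
  intervalIntegral.integral_eq_sub_of_hasDerivAt (fun x _ => hasDerivAt_cutPrim ha x)
    (((continuous_cut ha).pow 2).intervalIntegrable _ _)

lemma arctan_add_le (y : ℝ) : Real.arctan y + y / (1 + y ^ 2) ≤ Real.pi / 2 := by
  -- with `θ = π/2 - arctan y` this says `sin θ cos θ ≤ θ`
  have h0 : 0 ≤ Real.pi / 2 - Real.arctan y := by linarith [Real.arctan_lt_pi_div_two y]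
  have h1 := Real.sin_le h0
  rw [Real.sin_pi_div_two_sub] at h1
  have h2 : y / (1 + y ^ 2) = Real.cos (Real.arctan y) * Real.sin (Real.arctan y) := by
    rw [Real.cos_arctan, Real.sin_arctan]
    have hs : 0 < 1 + y ^ 2 := by positivity
    rw [div_mul_div_comm, Real.mul_self_sqrt hs.le, one_mul]
  have h3 := Real.sin_le_one (Real.arctan y)
  have h4 := Real.cos_arctan_pos y
  rw [h2]
  nlinarith

lemma cutPrim_le {a : ℝ} (ha : 0 < a) (x : ℝ) : cutPrim a x ≤ Real.pi * a / 4 := by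
  have h := arctan_add_le (x / a)
  have h2 : cutPrim a x = a / 2 * (Real.arctan (x / a) + x / a / (1 + (x / a) ^ 2)) := by
    unfold cutPrim
    have : 1 + (x / a) ^ 2 = (x ^ 2 + a ^ 2) / a ^ 2 := by field_simp; ring
    rw [this]
    field_simp
    ring
  rw [h2]
  nlinarith

lemma cutPrim_zero (a : ℝ) : cutPrim a 0 = 0 := by simp [cutPrim]

/-- On the interval `[n² - 1, (n + 1)² - 1]` around `λ = n (n + 1)` the mean of `(cut a)²` is at
least its value at `λ`: it is a convex function of `x²`, whose mean is at most `λ²`. -/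
lemma mul_cut_lam_sq_le {a : ℝ} (ha : 0 < a) (m : ℕ) : (2 * m + 3) * cut a (lam m) ^ 2
    ≤ cutPrim a ((m + 1 : ℕ) ^ 2 + 2 * (m + 1 : ℕ)) - cutPrim a (m ^ 2 + 2 * m) := by
  rw [← integral_cut_sq ha]
  set z := lam m ^ 2 + a ^ 2 with hz
  have hz0 : 0 < z := by positivity
  have hle : ((m : ℝ) ^ 2 + 2 * m) ≤ ((m + 1 : ℕ) ^ 2 + 2 * (m + 1 : ℕ)) := by
    push_cast; nlinarith [(Nat.cast_nonneg m : (0 : ℝ) ≤ m)]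
  have hmono : ∫ x in ((m : ℝ) ^ 2 + 2 * m)..((m + 1 : ℕ) ^ 2 + 2 * (m + 1 : ℕ)),
      (a ^ 4 / z ^ 2 - 2 * a ^ 4 / z ^ 3 * (x ^ 2 - lam m ^ 2))
      ≤ ∫ x in ((m : ℝ) ^ 2 + 2 * m)..((m + 1 : ℕ) ^ 2 + 2 * (m + 1 : ℕ)), cut a x ^ 2 := by
    refine intervalIntegral.integral_mono_on hle (Continuous.intervalIntegrable (by fun_prop) _ _)
      (((continuous_cut ha).pow 2).intervalIntegrable _ _) fun x _ => ?_
    -- the tangent line of `y ↦ y⁻²` at `z`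
    have hy0 : 0 < x ^ 2 + a ^ 2 := by positivity
    set y := x ^ 2 + a ^ 2 with hy
    have e1 : x ^ 2 - lam m ^ 2 = y - z := by rw [hy, hz]; ring
    have e2 : cut a x ^ 2 = a ^ 4 / y ^ 2 := by rw [cut, div_pow, ← pow_mul, ← hy]
    rw [e1, e2]
    have e3 : a ^ 4 / y ^ 2 - (a ^ 4 / z ^ 2 - 2 * a ^ 4 / z ^ 3 * (y - z))
        = a ^ 4 * (y - z) ^ 2 * (z + 2 * y) / (y ^ 2 * z ^ 3) := by
      field_simp; ring
    have : 0 ≤ a ^ 4 * (y - z) ^ 2 * (z + 2 * y) / (y ^ 2 * z ^ 3) := by positivity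
    linarith
  refine le_trans ?_ hmono
  rw [intervalIntegral.integral_sub, intervalIntegral.integral_const_mul,
    intervalIntegral.integral_sub, integral_pow, intervalIntegral.integral_const,
    intervalIntegral.integral_const]
  · have e2 : cut a (lam m) ^ 2 = a ^ 4 / z ^ 2 := by rw [cut, div_pow, ← pow_mul, ← hz]
    rw [e2]
    have hm : (0 : ℝ) ≤ m := Nat.cast_nonneg m
    have e4 : ((((m + 1 : ℕ) : ℝ) ^ 2 + 2 * (m + 1 : ℕ)) ^ (2 + 1)
        - ((m : ℝ) ^ 2 + 2 * m) ^ (2 + 1)) / ((2 : ℕ) + 1)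
        - ((((m + 1 : ℕ) : ℝ) ^ 2 + 2 * (m + 1 : ℕ)) - ((m : ℝ) ^ 2 + 2 * m)) • lam m ^ 2
        = -(2 * m + 3) * (2 * m ^ 2 + 6 * m + 3) / 3 := by
      unfold lam; push_cast; rw [smul_eq_mul]; ring
    rw [e4]
    have e5 : ((((m + 1 : ℕ) : ℝ) ^ 2 + 2 * (m + 1 : ℕ)) - ((m : ℝ) ^ 2 + 2 * m)) = 2 * m + 3 := by
      push_cast; ring
    rw [e5, smul_eq_mul]
    have : 0 ≤ 2 * a ^ 4 / z ^ 3 * ((2 * m + 3) * (2 * m ^ 2 + 6 * m + 3) / 3) := by positivity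
    nlinarith
  all_goals exact Continuous.intervalIntegrable (by fun_prop) _ _

/-- The spectral density bound `∑ (2 n + 1) (cut a (n (n + 1)))² ≤ π a / 4`. -/
theorem sum_mul_cut_sq_le {a : ℝ} (ha : 0 < a) (N : ℕ) :
    ∑ m ∈ Finset.range N, (2 * m + 3) * cut a (lam m) ^ 2 ≤ Real.pi * a / 4 := by
  calc ∑ m ∈ Finset.range N, (2 * m + 3) * cut a (lam m) ^ 2
      ≤ ∑ m ∈ Finset.range N, (cutPrim a ((m + 1 : ℕ) ^ 2 + 2 * (m + 1 : ℕ))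
          - cutPrim a (m ^ 2 + 2 * m)) := Finset.sum_le_sum fun m _ => mul_cut_lam_sq_le ha m
    _ = cutPrim a (N ^ 2 + 2 * N) := by
        rw [Finset.sum_range_sub (fun m : ℕ => cutPrim a ((m : ℝ) ^ 2 + 2 * m))]
        simp [cutPrim_zero]
    _ ≤ Real.pi * a / 4 := cutPrim_le ha _

lemma integral_cut_sq_le {a : ℝ} (ha : 0 < a) (M : ℝ) :
    ∫ x in (0 : ℝ)..M, cut a x ^ 2 ≤ Real.pi * a / 4 := by
  rw [integral_cut_sq ha, cutPrim_zero, sub_zero]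
  exact cutPrim_le ha M

lemma cut_add_cut {a x : ℝ} (ha : 0 < a) : cut a x + cut x a = 1 := by
  unfold cut
  have : x ^ 2 + a ^ 2 ≠ 0 := by positivity
  have : a ^ 2 + x ^ 2 ≠ 0 := by positivity
  field_simp
  ring

lemma integral_sub_sqrt_sq {a b : ℝ} (ha : 0 ≤ a) (hb : 0 < b) :
    ∫ x in (0 : ℝ)..(a / b) ^ 2, (a - b * √x) ^ 2 = a ^ 4 / (6 * b ^ 2) := by
  have hd : ∀ x ∈ Set.Ioo 0 ((a / b) ^ 2), HasDerivAt
      (fun x => a ^ 2 * x - 4 / 3 * a * b * (x * √x) + b ^ 2 / 2 * x ^ 2)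
      ((a - b * √x) ^ 2) x := fun x hx => by
    have h1 := (hasDerivAt_id x).fun_mul (Real.hasDerivAt_sqrt hx.1.ne')
    have h2 := ((hasDerivAt_id x).const_mul (a ^ 2)).fun_sub (h1.const_mul (4 / 3 * a * b))
    have h3 := h2.fun_add ((hasDerivAt_pow 2 x).const_mul (b ^ 2 / 2))
    refine h3.congr_deriv ?_
    have hs := Real.sq_sqrt hx.1.le
    have hs0 : √x ≠ 0 := (Real.sqrt_pos.2 hx.1).ne'
    have h4 : x * (1 / (2 * √x)) = √x / 2 := by
      field_simp; linarith
    simp only [id, h4, Nat.add_one_sub_one, pow_one, Nat.cast_ofNat]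
    linear_combination (-b ^ 2) * hs
  rw [intervalIntegral.integral_eq_sub_of_hasDerivAt_of_le (by positivity) (by fun_prop) hd
    (Continuous.intervalIntegrable (by fun_prop) _ _), Real.sqrt_sq (by positivity)]
  field_simp
  simp
  ring

/-- The layer-cake step: a function which dominates `(a - b √x)²` as long as `b √x ≤ a`. -/
lemma le_integral_of_sub_sqrt_sq_le {a b M : ℝ} (ha : 0 ≤ a) (hb : 0 < b)
    (hM : (a / b) ^ 2 ≤ M) {f : ℝ → ℝ} (hf : Continuous f) (hf0 : ∀ x, 0 ≤ f x)
    (h : ∀ x, 0 < x → b * √x ≤ a → (a - b * √x) ^ 2 ≤ f x) :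
    a ^ 4 / (6 * b ^ 2) ≤ ∫ x in (0 : ℝ)..M, f x := by
  rw [← integral_sub_sqrt_sq ha hb]
  have h0 : 0 ≤ (a / b) ^ 2 := by positivity
  calc ∫ x in (0 : ℝ)..(a / b) ^ 2, (a - b * √x) ^ 2 ≤ ∫ x in (0 : ℝ)..(a / b) ^ 2, f x := by
        refine intervalIntegral.integral_mono_on_of_le_Ioo h0
          (Continuous.intervalIntegrable (by fun_prop) _ _) (hf.intervalIntegrable _ _)
          fun x hx => h x hx.1 ?_
        have := Real.sqrt_le_sqrt hx.2.le
        rw [Real.sqrt_sq (by positivity)] at this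
        calc b * √x ≤ b * (a / b) := by gcongr
          _ = a := by field_simp
    _ ≤ ∫ x in (0 : ℝ)..M, f x :=
        intervalIntegral.integral_mono_interval le_rfl h0 hM
          (Filter.Eventually.of_forall fun x => hf0 x) (hf.intervalIntegrable _ _)

/-! ### The interpolation inequality for truncated fields -/

/-- The truncation of the spectral expansion of `u`. -/
noncomputable def trunc (N : ℕ) (u : S2 → E3) : S2 → E3 := ∑ m ∈ Finset.range N, proj m u

lemma continuous_trunc (N : ℕ) {u : S2 → E3} (hu : MemLp u 2 area) : Continuous (trunc N u) := by
  have h : trunc N u = fun x => ∑ m ∈ Finset.range N, proj m u x := by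
    ext1 x; rw [trunc, Finset.sum_apply]
  rw [h]
  exact continuous_finsetSum _ fun m _ => continuous_proj m hu

lemma memLp_trunc (N : ℕ) {u : S2 → E3} (hu : MemLp u 2 area) : MemLp (trunc N u) 2 area :=
  continuous_memLp (continuous_trunc N hu) 2

lemma isTangent_trunc (N : ℕ) {u : S2 → E3} (hu : MemLp u 2 area) : IsTangent (trunc N u) :=
  Filter.Eventually.of_forall fun x => by
    rw [trunc, Finset.sum_apply, inner_sum]
    exact Finset.sum_eq_zero fun m _ => inner_left_proj m hu x

lemma op_jac_trunc {m N : ℕ} (hm : m < N) {u : S2 → E3} (hu : MemLp u 2 area)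
    (hut : IsTangent u) : op (jac m) (trunc N u) = op (jac m) u := by
  rw [trunc, op_field_sum _ _ _ fun n _ => (memLp_proj n hu).integrable one_le_two,
    Finset.sum_eq_single_of_mem m (Finset.mem_range.2 hm) fun n _ hn => by
      rw [proj, op_smul, op_jac_op_jac_ne hn hu hut, smul_zero],
    proj, op_smul, kap_smul_op_jac_op_jac m hu hut]

/-- The pointwise bound of a zonal operator by the `L₂` norm of its kernel, which is
`√(16 π wip q q)`, and the Cauchy-Schwarz inequality. -/
lemma normSq_op_le_wip (q : ℝ[X]) {K : ℝ} (hK : 0 < K) (hqK : 16 * Real.pi * wip q q ≤ K)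
    {w : S2 → E3} (hw : MemLp w 2 area) (hwt : IsTangent w) (x : S2) :
    ‖op q w x‖ ^ 2 ≤ K * ∫ y, ‖w y‖ ^ 2 ∂area := by
  have hw1 := hw.integrable one_le_two
  set e := op q w x with he
  have hex : ⟪(x : E3), e⟫ = 0 := inner_left_op hw1 x
  have hnorm : ∫ y : S2, (q.eval (hav x y) * (2 * (1 - hav x y))) ^ 2 ∂area
      = 16 * Real.pi * wip q q := by
    have h := integral_zonal' ((q * (2 * (1 - X))) ^ 2) x
    simp only [eval_mul, eval_pow, eval_sub, eval_one, eval_X, eval_ofNat] at h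
    have h' : ∀ t : ℝ, (q.eval t * (2 * (1 - t))) ^ 2
        = 4 * ((1 - t) ^ 2 * (q.eval t * q.eval t)) := fun t => by ring
    rw [h]
    simp only [h', wip, intervalIntegral.integral_const_mul]
    ring
  have i1 : Integrable (fun y : S2 => (q.eval (hav x y) * (2 * (1 - hav x y))) ^ 2) area :=
    continuous_integrable (by fun_prop)
  have h1 : ⟪e, e⟫ ≤ ∫ y, (K / 2 * ‖w y‖ ^ 2
      + ‖e‖ ^ 2 / (2 * K) * (q.eval (hav x y) * (2 * (1 - hav x y))) ^ 2) ∂area := by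
    conv_lhs => rw [he, inner_op hw1]
    refine integral_mono_ae ?_ (((integrable_normSq hw).const_mul _).add (i1.const_mul _))
      (hwt.mono fun y hy => ?_)
    · have := (integrable_op (q := q) hw1 x).inner_const (𝕜 := ℝ) (op q w x)
      simpa only [real_inner_smul_left] using this
    · simp only
      rw [← he, inner_ker_symm hex hy]
      have h2 : |⟪w y, ker y x e⟫| ≤ ‖w y‖ * (2 * (1 - hav x y) * ‖e‖) := by
        refine (abs_real_inner_le_norm _ _).trans (le_of_eq ?_)
        rw [norm_ker hex, one_add_inner_eq_hav, hav_comm]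
      set c := q.eval (hav x y)
      set h := 1 - hav x y
      have h3 : c * ⟪w y, ker y x e⟫ ≤ |c| * (‖w y‖ * (2 * h * ‖e‖)) :=
        (le_abs_self _).trans (by rw [abs_mul]; gcongr)
      have h4 : K / 2 * ‖w y‖ ^ 2 + ‖e‖ ^ 2 / (2 * K) * (c * (2 * h)) ^ 2
          - |c| * (‖w y‖ * (2 * h * ‖e‖)) = (K * ‖w y‖ - |c| * (2 * h * ‖e‖)) ^ 2 / (2 * K) := by
        field_simp
        rw [← sq_abs c]
        ring
      have h5 : 0 ≤ (K * ‖w y‖ - |c| * (2 * h * ‖e‖)) ^ 2 / (2 * K) := by positivity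
      linarith
  rw [integral_add ((integrable_normSq hw).const_mul _) (i1.const_mul _), integral_const_mul,
    integral_const_mul, hnorm, real_inner_self_eq_norm_sq] at h1
  have h6 : ‖e‖ ^ 2 / (2 * K) * (16 * Real.pi * wip q q) ≤ ‖e‖ ^ 2 / (2 * K) * K := by gcongr
  have h7 : ‖e‖ ^ 2 / (2 * K) * K = ‖e‖ ^ 2 / 2 := by field_simp
  linarith

/-- The low frequency part of a truncated field is bounded pointwise by the norm of the field, with
the spectral density as the constant. -/
lemma norm_low_le (N : ℕ) {a : ℝ} (ha : 0 < a) {u : S2 → E3} (hu : MemLp u 2 area)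
    (hut : IsTangent u) (x : S2) :
    ‖∑ m ∈ Finset.range N, cut a (lam m) • proj m u x‖ ^ 2
      ≤ a / 16 * ∫ y, ‖trunc N u y‖ ^ 2 ∂area := by
  set q : ℝ[X] := ∑ m ∈ Finset.range N, C (cut a (lam m) * kap m) * jac m with hq
  have hw := memLp_trunc N hu
  have h1 : op q (trunc N u) x = ∑ m ∈ Finset.range N, cut a (lam m) • proj m u x := by
    rw [hq, op_poly_sum _ _ (hw.integrable one_le_two), Finset.sum_apply]
    refine Finset.sum_congr rfl fun m hm => ?_
    rw [op_C_mul, op_jac_trunc (Finset.mem_range.1 hm) hu hut, Pi.smul_apply, proj, Pi.smul_apply,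
      smul_smul]
  have h2 : wip q q = ∑ m ∈ Finset.range N, (cut a (lam m) * kap m) ^ 2 / (2 * m + 3) := by
    conv_lhs => rw [hq, wip_sum_right]
    refine Finset.sum_congr rfl fun m hm => ?_
    rw [wip_C_mul_right, wip_comm, wip_sum_right, Finset.sum_eq_single_of_mem m hm fun n _ hn => by
      rw [wip_C_mul_right, wip_jac_ne hn.symm, mul_zero], wip_C_mul_right, wip_jac_self]
    ring
  rw [← h1]
  refine normSq_op_le_wip q (by positivity) ?_ hw (isTangent_trunc N hu) x
  have h3 : 16 * Real.pi * wip q q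
      = 1 / (4 * Real.pi) * ∑ m ∈ Finset.range N, (2 * m + 3) * cut a (lam m) ^ 2 := by
    rw [h2, Finset.mul_sum, Finset.mul_sum]
    refine Finset.sum_congr rfl fun m _ => ?_
    unfold kap
    have := Real.pi_ne_zero
    have : (2 * m + 3 : ℝ) ≠ 0 := by positivity
    field_simp
    ring
  rw [h3]
  calc 1 / (4 * Real.pi) * ∑ m ∈ Finset.range N, (2 * m + 3) * cut a (lam m) ^ 2
      ≤ 1 / (4 * Real.pi) * (Real.pi * a / 4) := by
        have := Real.pi_pos
        gcongr
        exact sum_mul_cut_sq_le ha N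
    _ = a / 16 := by have := Real.pi_ne_zero; field_simp; ring

/-- The high frequency part of the truncation of `u`, at the level `a`. -/
noncomputable def high (N : ℕ) (u : S2 → E3) (a : ℝ) (x : S2) : E3 :=
  ∑ m ∈ Finset.range N, cut (lam m) a • proj m u x

lemma trunc_eq_high_add (N : ℕ) (u : S2 → E3) (a : ℝ) (x : S2) :
    trunc N u x = high N u a x + ∑ m ∈ Finset.range N, cut a (lam m) • proj m u x := by
  rw [trunc, Finset.sum_apply, high, ← Finset.sum_add_distrib]
  refine Finset.sum_congr rfl fun m _ => ?_
  rw [← add_smul, cut_add_cut (lam_pos m), one_smul]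

lemma continuous_normSq_high (N : ℕ) {u : S2 → E3} (hu : MemLp u 2 area) :
    Continuous (Function.uncurry fun x a => ‖high N u a x‖ ^ 2) := by
  change Continuous fun p : S2 × ℝ => ‖high N u p.2 p.1‖ ^ 2
  unfold high
  refine (continuous_finsetSum _ fun m _ => ?_).norm.pow 2
  have h1 : Continuous fun p : S2 × ℝ => cut (lam m) p.2 :=
    (continuous_cut (lam_pos m)).comp continuous_snd
  have h2 : Continuous fun p : S2 × ℝ => proj m u p.1 :=
    (continuous_proj m hu).comp continuous_fst
  exact h1.smul h2

lemma continuous_high_level (N : ℕ) (u : S2 → E3) (x : S2) : Continuous fun a => high N u a x := by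
  unfold high
  exact continuous_finsetSum _ fun m _ => (continuous_cut (lam_pos m)).smul continuous_const

lemma integral_normSq_high (N : ℕ) (a : ℝ) {u : S2 → E3} (hu : MemLp u 2 area)
    (hut : IsTangent u) : ∫ x, ‖high N u a x‖ ^ 2 ∂area
      = ∑ m ∈ Finset.range N, cut (lam m) a ^ 2 * ∫ x, ‖proj m u x‖ ^ 2 ∂area := by
  have h1 : ∀ x, ‖high N u a x‖ ^ 2 = ∑ m ∈ Finset.range N, ∑ n ∈ Finset.range N,
      cut (lam m) a * cut (lam n) a * ⟪proj m u x, proj n u x⟫ := fun x => by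
    rw [← real_inner_self_eq_norm_sq, high, sum_inner]
    refine Finset.sum_congr rfl fun m _ => ?_
    rw [inner_sum]
    refine Finset.sum_congr rfl fun n _ => ?_
    rw [real_inner_smul_left, inner_smul_right]; ring
  have hc : ∀ m n, Continuous fun x => cut (lam m) a * cut (lam n) a * ⟪proj m u x, proj n u x⟫ :=
    fun m n => by
      have := continuous_proj m hu
      have := continuous_proj n hu
      fun_prop
  simp only [h1]
  rw [integral_finsetSum _ fun m _ =>
    continuous_integrable (continuous_finsetSum _ fun n _ => hc m n)]
  refine Finset.sum_congr rfl fun m hm => ?_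
  rw [integral_finsetSum _ fun n _ => continuous_integrable (hc m n)]
  simp only [integral_const_mul, integral_inner_proj_proj _ _ hu hut, mul_ite, mul_zero]
  rw [Finset.sum_ite_eq, if_pos hm]
  ring

lemma integral_swap_of_continuous {α : Type*} [TopologicalSpace α] [CompactSpace α]
    [MeasurableSpace α] [OpensMeasurableSpace α] [SecondCountableTopology α] {μ : Measure α}
    [IsFiniteMeasure μ] {F : α → ℝ → ℝ} {M : ℝ} (hM : 0 ≤ M)
    (hF : Continuous (Function.uncurry F)) :
    Integrable (fun x => ∫ a in (0 : ℝ)..M, F x a) μ ∧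
      ∫ x, (∫ a in (0 : ℝ)..M, F x a) ∂μ = ∫ a in (0 : ℝ)..M, (∫ x, F x a ∂μ) := by
  have hprod : Integrable (Function.uncurry F) (μ.prod (volume.restrict (Set.Ioc 0 M))) := by
    obtain ⟨C, hC⟩ := ((isCompact_univ (X := α)).prod
      (isCompact_Icc (a := (0 : ℝ)) (b := M))).exists_bound_of_continuousOn hF.continuousOn
    refine Integrable.of_bound hF.aestronglyMeasurable C ?_
    have h1 : ∀ᵐ p : α × ℝ ∂(μ.prod (volume.restrict (Set.Ioc 0 M))), p.2 ∈ Set.Ioc 0 M :=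
      Measure.quasiMeasurePreserving_snd.ae (ae_restrict_mem measurableSet_Ioc)
    filter_upwards [h1] with p hp
    exact hC p ⟨Set.mem_univ _, Set.Ioc_subset_Icc_self hp⟩
  simp only [intervalIntegral.integral_of_le hM]
  exact ⟨hprod.integral_prod_left, integral_integral_swap hprod⟩

/-- Integrated over the levels, the high frequency part at a point dominates the fourth power of the
norm of the field, since its norm is at least `|trunc N u x| - b √a`. -/
lemma pow_four_div_le_integral_high (N : ℕ) {u : S2 → E3} (hu : MemLp u 2 area)
    (hut : IsTangent u) {b M : ℝ} (hb : 0 < b)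
    (hb2 : b ^ 2 = (∫ y, ‖trunc N u y‖ ^ 2 ∂area) / 16) (x : S2)
    (hM : (‖trunc N u x‖ / b) ^ 2 ≤ M) :
    ‖trunc N u x‖ ^ 4 / (6 * b ^ 2) ≤ ∫ a in (0 : ℝ)..M, ‖high N u a x‖ ^ 2 := by
  have hc : Continuous fun a => ‖high N u a x‖ ^ 2 := (continuous_high_level N u x).norm.pow 2
  refine le_integral_of_sub_sqrt_sq_le (norm_nonneg _) hb hM hc (fun a => sq_nonneg _) ?_
  intro a ha hab
  have h1 := norm_low_le N ha hu hut x
  have h3 := trunc_eq_high_add N u a x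
  generalize hL : ∑ m ∈ Finset.range N, cut a (lam m) • proj m u x = L at h1 h3
  have h2 : ‖L‖ ≤ b * √a := by
    refine abs_le_of_sq_le_sq' ?_ (by positivity) |>.2
    rw [mul_pow, hb2, Real.sq_sqrt ha.le]
    linarith
  have h4 : ‖trunc N u x‖ ≤ ‖high N u a x‖ + ‖L‖ := by rw [h3]; exact norm_add_le _ _
  exact pow_le_pow_left₀ (by linarith) (by linarith) 2

/-- The interpolation inequality for truncated fields, with the spectral energy. -/
theorem integral_trunc_pow_four_le (N : ℕ) {u : S2 → E3} (hu : MemLp u 2 area)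
    (hut : IsTangent u) : ∫ x, ‖trunc N u x‖ ^ 4 ∂area
      ≤ 3 * Real.pi / 32 * (∫ x, ‖trunc N u x‖ ^ 2 ∂area)
        * ∑ m ∈ Finset.range N, lam m * ∫ x, ‖proj m u x‖ ^ 2 ∂area := by
  set w := trunc N u with hw
  have hwc : Continuous w := continuous_trunc N hu
  have hwL := memLp_trunc N hu
  set W := ∫ x, ‖w x‖ ^ 2 ∂area with hW
  have hW0 : 0 ≤ W := integral_nonneg fun x => sq_nonneg _
  rcases hW0.eq_or_lt with h0 | hWpos
  · have h1 := (integral_eq_zero_iff_of_nonneg (fun x => sq_nonneg _)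
      (integrable_normSq hwL)).1 (hW.symm.trans h0.symm)
    have h2 : ∫ x, ‖w x‖ ^ 4 ∂area = 0 := by
      rw [← integral_zero S2 ℝ (μ := area)]
      refine integral_congr_ae (h1.mono fun x hx => ?_)
      simpa using hx
    rw [h2, ← h0]; simp
  obtain ⟨B, hB⟩ := isCompact_univ.exists_bound_of_continuousOn hwc.continuousOn
  have hBw : ∀ x, ‖w x‖ ≤ B := fun x => hB x (Set.mem_univ _)
  set b := √W / 4 with hb
  have hb0 : 0 < b := by positivity
  have hb2 : b ^ 2 = W / 16 := by rw [hb, div_pow, Real.sq_sqrt hW0]; norm_num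
  set M := (B / b) ^ 2 with hM
  have hM0 : 0 ≤ M := sq_nonneg _
  have hHc := continuous_normSq_high N hu
  have hlow : ∀ x, ‖w x‖ ^ 4 / (6 * b ^ 2) ≤ ∫ a in (0 : ℝ)..M, ‖high N u a x‖ ^ 2 := fun x => by
    refine pow_four_div_le_integral_high N hu hut hb0 hb2 x ?_
    have := hBw x
    rw [hM]
    gcongr
  obtain ⟨hint, hswap⟩ := integral_swap_of_continuous (μ := area) hM0 hHc
  have hup : ∫ a in (0 : ℝ)..M, ∫ x, ‖high N u a x‖ ^ 2 ∂area
      ≤ Real.pi / 4 * ∑ m ∈ Finset.range N, lam m * ∫ x, ‖proj m u x‖ ^ 2 ∂area := by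
    simp only [integral_normSq_high N _ hu hut]
    rw [intervalIntegral.integral_finsetSum, Finset.mul_sum]
    swap
    · intro m _
      have h := continuous_cut (lam_pos m)
      exact Continuous.intervalIntegrable (by fun_prop) _ _
    refine Finset.sum_le_sum fun m _ => ?_
    rw [intervalIntegral.integral_mul_const]
    have h1 := integral_cut_sq_le (lam_pos m) M
    have h2 : 0 ≤ ∫ x, ‖proj m u x‖ ^ 2 ∂area := integral_nonneg fun x => sq_nonneg _
    calc (∫ x in (0 : ℝ)..M, cut (lam m) x ^ 2) * ∫ x, ‖proj m u x‖ ^ 2 ∂area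
        ≤ Real.pi * lam m / 4 * ∫ x, ‖proj m u x‖ ^ 2 ∂area := by gcongr
      _ = _ := by ring
  have hfin : ∫ x, ‖w x‖ ^ 4 / (6 * b ^ 2) ∂area
      ≤ Real.pi / 4 * ∑ m ∈ Finset.range N, lam m * ∫ x, ‖proj m u x‖ ^ 2 ∂area :=
    ((integral_mono (continuous_integrable (by fun_prop)) hint hlow).trans_eq hswap).trans hup
  rw [integral_div, hb2, div_le_iff₀ (by positivity)] at hfin
  linarith

/-! ### The limit of the truncations -/

lemma integral_inner_trunc_proj {N n : ℕ} (hn : n < N) {u : S2 → E3} (hu : MemLp u 2 area)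
    (hut : IsTangent u) :
    ∫ x, ⟪trunc N u x, proj n u x⟫ ∂area = ∫ x, ‖proj n u x‖ ^ 2 ∂area := by
  have h1 : ∀ x, ⟪trunc N u x, proj n u x⟫
      = ∑ m ∈ Finset.range N, ⟪proj m u x, proj n u x⟫ := fun x => by
    rw [trunc, Finset.sum_apply, sum_inner]
  simp only [h1]
  rw [integral_finsetSum _ fun m _ => integrable_inner_of_memLp (memLp_proj m hu) (memLp_proj n hu)]
  simp only [integral_inner_proj_proj _ _ hu hut]
  rw [Finset.sum_ite_eq_of_mem' _ _ _ (Finset.mem_range.2 hn)]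

lemma integral_inner_sub_trunc_proj {N n : ℕ} (hn : n < N) {u : S2 → E3} (hu : MemLp u 2 area)
    (hut : IsTangent u) : ∫ x, ⟪u x - trunc N u x, proj n u x⟫ ∂area = 0 := by
  simp only [inner_sub_left]
  rw [integral_sub (integrable_inner_of_memLp hu (memLp_proj n hu))
    (integrable_inner_of_memLp (memLp_trunc N hu) (memLp_proj n hu)),
    integral_inner_trunc_proj hn hu hut, ← integral_inner_proj_self n hu hut]
  simp only [real_inner_comm, sub_self]

/-- Pythagoras' theorem: the truncation is the best approximation of `u` by linear combinations of
its projections. -/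
lemma integral_normSq_sub_trunc_add (N : ℕ) (c : ℕ → ℝ) {u : S2 → E3} (hu : MemLp u 2 area)
    (hut : IsTangent u) : ∫ x, ‖u x - trunc N u x‖ ^ 2 ∂area
      + ∫ x, ‖trunc N u x - ∑ n ∈ Finset.range N, c n • proj n u x‖ ^ 2 ∂area
      = ∫ x, ‖u x - ∑ n ∈ Finset.range N, c n • proj n u x‖ ^ 2 ∂area := by
  have hw := hu.sub (memLp_trunc N hu)
  have h1 : ∀ x, trunc N u x - ∑ n ∈ Finset.range N, c n • proj n u x
      = ∑ n ∈ Finset.range N, (1 - c n) • proj n u x := fun x => by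
    rw [trunc, Finset.sum_apply, ← Finset.sum_sub_distrib]
    exact Finset.sum_congr rfl fun n _ => by rw [sub_smul, one_smul]
  have h2 : ∫ x, ⟪u x - trunc N u x, trunc N u x - ∑ n ∈ Finset.range N, c n • proj n u x⟫ ∂area
      = 0 := by
    simp only [h1, inner_sum, inner_smul_right]
    rw [integral_finsetSum]
    swap
    · intro n _
      exact (integrable_inner_of_memLp hw (memLp_proj n hu)).const_mul (1 - c n)
    refine Finset.sum_eq_zero fun n hn => ?_
    rw [integral_const_mul, integral_inner_sub_trunc_proj (Finset.mem_range.1 hn) hu hut, mul_zero]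
  have hv : MemLp (fun x => trunc N u x - ∑ n ∈ Finset.range N, c n • proj n u x) 2 area := by
    refine continuous_memLp ((continuous_trunc N hu).sub ?_) 2
    exact continuous_finsetSum _ fun n _ => (continuous_proj n hu).const_smul (c n)
  have h3 : ∀ x, ‖u x - ∑ n ∈ Finset.range N, c n • proj n u x‖ ^ 2
      = ‖u x - trunc N u x‖ ^ 2
        + 2 * ⟪u x - trunc N u x, trunc N u x - ∑ n ∈ Finset.range N, c n • proj n u x⟫
        + ‖trunc N u x - ∑ n ∈ Finset.range N, c n • proj n u x‖ ^ 2 := fun x => by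
    rw [← norm_add_sq_real, sub_add_sub_cancel]
  simp only [h3]
  have i1 : Integrable (fun x => ‖u x - trunc N u x‖ ^ 2) area := integrable_normSq hw
  have i2 : Integrable (fun x => 2 * ⟪u x - trunc N u x,
      trunc N u x - ∑ n ∈ Finset.range N, c n • proj n u x⟫) area :=
    (integrable_inner_of_memLp hw hv).const_mul 2
  have i12 := i1.add i2
  simp only [Pi.add_def] at i12
  rw [integral_add i12 (integrable_normSq hv), integral_add i1 i2, integral_const_mul, h2,
    mul_zero, add_zero]

lemma integral_normSq_trunc_le (N : ℕ) {u : S2 → E3} (hu : MemLp u 2 area)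
    (hut : IsTangent u) : ∫ x, ‖trunc N u x‖ ^ 2 ∂area ≤ ∫ x, ‖u x‖ ^ 2 ∂area := by
  have h := integral_normSq_sub_trunc_add N 0 hu hut
  simp only [Pi.zero_apply, zero_smul, Finset.sum_const_zero, sub_zero] at h
  rw [← h]
  exact le_add_of_nonneg_left (integral_nonneg fun x => sq_nonneg _)

/-- The approximate identity of degree `k` has its values in the span of the first `k + 1`
projections. -/
lemma exists_op_peak_eq (k : ℕ) {u : S2 → E3} (hu : MemLp u 2 area) : ∃ c : ℕ → ℝ,
    ∀ x, op (peak k) u x = ∑ n ∈ Finset.range (k + 1), c n • proj n u x := by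
  obtain ⟨b, hb⟩ := exists_jac_expansion (k + 1) (peak k) fun j hj => coeff_peak_eq_zero k hj
  refine ⟨fun n => b n / kap n, fun x => ?_⟩
  rw [hb, op_poly_sum _ _ (hu.integrable one_le_two), Finset.sum_apply]
  refine Finset.sum_congr rfl fun n _ => ?_
  rw [op_C_mul, proj, Pi.smul_apply, Pi.smul_apply, smul_smul, div_mul_cancel₀ _ (kap_pos n).ne']

lemma tendsto_eLpNorm_trunc {u : S2 → E3} (hu : MemLp u 2 area) (hut : IsTangent u) :
    Filter.Tendsto (fun k => eLpNorm (trunc (k + 1) u - u) 2 area) Filter.atTop (nhds 0) := by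
  refine tendsto_of_tendsto_of_tendsto_of_le_of_le tendsto_const_nhds
    (tendsto_eLpNorm_op_peak hu hut) (fun k => zero_le) fun k => ?_
  obtain ⟨c, hc⟩ := exists_op_peak_eq k hu
  simp only
  rw [← ENNReal.pow_le_pow_left_iff two_ne_zero, eLpNorm_two_sq ((memLp_trunc _ hu).sub hu),
    eLpNorm_two_sq ((memLp_op _ hu).sub hu)]
  refine ENNReal.ofReal_le_ofReal ?_
  simp only [Pi.sub_apply, norm_sub_rev _ (u _), hc]
  rw [← integral_normSq_sub_trunc_add (k + 1) c hu hut]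
  exact le_add_of_nonneg_right (integral_nonneg fun x => sq_nonneg _)

lemma eLpNorm_four_pow (f : S2 → E3) :
    eLpNorm f 4 area ^ 4 = ∫⁻ s, ‖f s‖ₑ ^ 4 ∂area := by
  have h := eLpNorm_nnreal_pow_eq_lintegral (μ := area) (f := f) (p := 4) (by norm_num)
  norm_num at h
  exact_mod_cast h

lemma lintegral_trunc_pow_four_le (N : ℕ) {u : S2 → E3} {d r : S2 → ℝ} (hu : MemLp u 2 area)
    (hut : IsTangent u) (hd : IsWeakDiv u d) (hr : IsWeakDiv (perp u) r) :
    ∫⁻ s, ‖trunc N u s‖ₑ ^ 4 ∂area ≤ ENNReal.ofReal (3 * Real.pi / 32) * eLpNorm u 2 area ^ 2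
      * (eLpNorm r 2 area ^ 2 + eLpNorm d 2 area ^ 2) := by
  have hc := continuous_trunc N hu
  have hint : ∀ {g : S2 → ℝ}, 0 ≤ ∫ x, ‖g x‖ ^ 2 ∂area :=
    fun {g} => integral_nonneg fun x => sq_nonneg _
  have h1 : ∫⁻ s, ‖trunc N u s‖ₑ ^ 4 ∂area = ENNReal.ofReal (∫ x, ‖trunc N u x‖ ^ 4 ∂area) := by
    have hi : Integrable (fun x => ‖trunc N u x‖ ^ 4) area :=
      continuous_integrable (hc.norm.pow 4)
    rw [ofReal_integral_eq_lintegral_ofReal hi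
      (Filter.Eventually.of_forall fun s => by positivity)]
    congr 1; ext1 s
    rw [ENNReal.ofReal_pow (norm_nonneg _), ofReal_norm]
  rw [h1, eLpNorm_two_sq hu, eLpNorm_two_sq hr.1, eLpNorm_two_sq hd.1,
    ← ENNReal.ofReal_add hint hint, ← ENNReal.ofReal_mul (by positivity),
    ← ENNReal.ofReal_mul (mul_nonneg (by positivity) (integral_nonneg fun x => sq_nonneg _))]
  refine ENNReal.ofReal_le_ofReal ((integral_trunc_pow_four_le N hu hut).trans ?_)
  have h2 := integral_normSq_trunc_le N hu hut
  have h3 := sum_lam_mul_normSq_proj_le N hu hut hd hr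
  have h4 : 0 ≤ ∑ m ∈ Finset.range N, lam m * ∫ x, ‖proj m u x‖ ^ 2 ∂area :=
    Finset.sum_nonneg fun m _ =>
      mul_nonneg (lam_pos m).le (integral_nonneg fun x => sq_nonneg _)
  have h5 : 0 ≤ ∫ x, ‖u x‖ ^ 2 ∂area := integral_nonneg fun x => sq_nonneg _
  simp only [Real.norm_eq_abs, sq_abs]
  rw [add_comm] at h3
  gcongr

/-- The interpolation inequality for a field with weak divergence and rotation in `L₂`, by Fatou's
lemma along a subsequence of the truncations. -/
theorem eLpNorm_four_pow_le {u : S2 → E3} {d r : S2 → ℝ} (hu : MemLp u 2 area)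
    (hut : IsTangent u) (hd : IsWeakDiv u d) (hr : IsWeakDiv (perp u) r) :
    eLpNorm u 4 area ^ 4 ≤ ENNReal.ofReal (3 * Real.pi / 32) * eLpNorm u 2 area ^ 2
      * (eLpNorm r 2 area ^ 2 + eLpNorm d 2 area ^ 2) := by
  have hm := tendstoInMeasure_of_tendsto_eLpNorm two_ne_zero
    (fun k => (memLp_trunc (k + 1) hu).1) hu.1 (tendsto_eLpNorm_trunc hu hut)
  obtain ⟨φ, -, hφ⟩ := hm.exists_seq_tendsto_ae
  rw [eLpNorm_four_pow]
  calc ∫⁻ s, ‖u s‖ₑ ^ 4 ∂area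
      = ∫⁻ s, Filter.liminf (fun k => ‖trunc (φ k + 1) u s‖ₑ ^ 4) Filter.atTop ∂area := by
        refine lintegral_congr_ae (hφ.mono fun s hs => ?_)
        exact (((ENNReal.continuous_pow 4).tendsto _).comp hs.enorm).liminf_eq.symm
    _ ≤ Filter.liminf (fun k => ∫⁻ s, ‖trunc (φ k + 1) u s‖ₑ ^ 4 ∂area) Filter.atTop := by
        refine lintegral_liminf_le fun k => ?_
        have := continuous_trunc (φ k + 1) hu
        exact (this.enorm.measurable).pow_const 4
    _ ≤ _ := by
        refine Filter.liminf_le_of_le (by isBoundedDefault) fun b hb => ?_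
        obtain ⟨k, hk⟩ := hb.exists
        exact hk.trans (lintegral_trunc_pow_four_le _ hu hut hd hr)

/-! ### Divergence and rotation of fields in `H¹`, and the best constant -/

lemma MemH1Tangent.memLp {u : S2 → E3} (hu : MemH1Tangent u) : MemLp u 2 area :=
  MemLp.of_eval_piLp fun i => (hu.2 i).1

lemma continuous_smoothDiv {X : E3 → E3} (hX : ContDiff ℝ ∞ X) :
    Continuous fun s : S2 => smoothDiv X s := by
  have h0 : Continuous fun s : S2 => fderiv ℝ X s :=
    (hX.continuous_fderiv (by simp)).comp continuous_subtype_val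
  have h1 : ∀ v : E3, Continuous fun s : S2 => fderiv ℝ X s v := fun v =>
    h0.clm_apply continuous_const
  have h2 : Continuous fun s : S2 => fderiv ℝ X s (s : E3) :=
    h0.clm_apply continuous_subtype_val
  unfold smoothDiv
  fun_prop

/-- The Leibniz rule for the divergence. -/
lemma smoothDiv_smul {φ : E3 → ℝ} {F : E3 → E3} (hφ : ContDiff ℝ ∞ φ) (hF : ContDiff ℝ ∞ F)
    {s : S2} (hs : ⟪(s : E3), F s⟫ = 0) :
    smoothDiv (fun x => φ x • F x) s = φ s * smoothDiv F s + fderiv ℝ φ s (F s) := by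
  have h : ∀ v : E3, fderiv ℝ (fun x => φ x • F x) s v
      = φ s • fderiv ℝ F s v + fderiv ℝ φ s v • F s := fun v => by
    rw [fderiv_fun_smul (hφ.differentiable (by simp)).differentiableAt
      (hF.differentiable (by simp)).differentiableAt]
    rfl
  have h2 : F s = ∑ i : Fin 3, F s i • EuclideanSpace.single i (1 : ℝ) := by
    apply ext3 <;> simp [Fin.sum_univ_three]
  have h3 : fderiv ℝ φ s (F s)
      = ∑ i : Fin 3, fderiv ℝ φ s (EuclideanSpace.single i 1) * F s i := by
    conv_lhs => rw [h2]
    rw [map_sum]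
    exact Finset.sum_congr rfl fun i _ => by rw [map_smul, smul_eq_mul, mul_comm]
  rw [smoothDiv, smoothDiv, h3]
  simp only [h, inner_add_right, inner_smul_right, hs, PiLp.add_apply, PiLp.smul_apply, smul_eq_mul,
    Finset.sum_add_distrib, ← Finset.mul_sum]
  ring

/-- The tangential part `x ↦ e_i - x_i x` of the `i`-th basis vector (on the sphere). -/
noncomputable def tanBasis (i : Fin 3) (x : E3) : E3 := EuclideanSpace.single i 1 - x i • x

lemma contDiff_tanBasis (i : Fin 3) : ContDiff ℝ ∞ (tanBasis i) := by
  unfold tanBasis; fun_prop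

lemma inner_tanBasis (i : Fin 3) (s : S2) : ⟪(s : E3), tanBasis i s⟫ = 0 := by
  rw [tanBasis, inner_sub_right, inner_smul_right, inner_self_sphere, inner_single_right]; ring

lemma smoothDiv_tanBasis (i : Fin 3) (s : S2) : smoothDiv (tanBasis i) s = -2 * (s : E3) i := by
  have h : ∀ v : E3, fderiv ℝ (tanBasis i) s v = -((s : E3) i • v + v i • (s : E3)) := fun v => by
    have h1 : HasFDerivAt (fun x : E3 => x i) (EuclideanSpace.proj i : E3 →L[ℝ] ℝ) (s : E3) :=
      (EuclideanSpace.proj i : E3 →L[ℝ] ℝ).hasFDerivAt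
    have h2 := (h1.fun_smul (hasFDerivAt_id (𝕜 := ℝ) (s : E3))).const_sub
      (EuclideanSpace.single i (1 : ℝ))
    have h3 : HasFDerivAt (tanBasis i) _ (s : E3) := h2
    rw [h3.fderiv]
    simp
  have hs := inner_self_sphere s
  rw [smoothDiv]
  simp only [h, inner_neg_right, inner_add_right, inner_smul_right, hs]
  fin_cases i <;> simp [Fin.sum_univ_three] <;> ring

/-- The generator `x ↦ a × x` of a rotation, as a continuous linear map. -/
noncomputable def crossLeft (a : E3) : E3 →L[ℝ] E3 := LinearMap.toContinuousLinearMap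
  { toFun := fun x => cross a x
    map_add' := cross_add_right a
    map_smul' := fun r x => cross_smul_right r a x }

lemma crossLeft_apply (a x : E3) : crossLeft a x = cross a x := rfl

lemma inner_crossLeft (a : E3) (s : S2) : ⟪(s : E3), crossLeft a s⟫ = 0 := cross_inner_self a s

lemma smoothDiv_crossLeft (a : E3) (s : S2) : smoothDiv (crossLeft a) s = 0 := by
  rw [smoothDiv]
  simp only [ContinuousLinearMap.fderiv, crossLeft_apply, cross_inner_self]
  simp [Fin.sum_univ_three]

/-- The weak gradients of the components of `u` give the divergence of the combination `w` of
smooth fields `F i` with the coefficients `u i`, if its pairing with gradients is as expected. -/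
lemma isWeakDiv_of_components {u w : S2 → E3} {G : Fin 3 → S2 → E3} {F : Fin 3 → E3 → E3}
    (hu : MemLp u 2 area) (hG : ∀ i, IsWeakGrad (fun s => u s i) (G i))
    (hF : ∀ i, ContDiff ℝ ∞ (F i)) (hFt : ∀ i (s : S2), ⟪(s : E3), F i s⟫ = 0)
    (hw : ∀ φ : E3 → ℝ, ContDiff ℝ ∞ φ → ∀ᵐ s : S2 ∂area, ⟪w s, sphereGrad φ s⟫
      = ∑ i, u s i * smoothDiv (fun x => φ x • F i x) s) :
    IsWeakDiv w fun s => ∑ i, ⟪G i s, F i s⟫ := by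
  have hc : ∀ i, Continuous fun s : S2 => F i s := fun i =>
    (hF i).continuous.comp continuous_subtype_val
  have hui : ∀ i, MemLp (fun s => u s i) 2 area := fun i => MemLp.eval_piLp hu i
  refine ⟨memLp_finsetSum _ fun i _ => ?_, fun φ hφ => ?_⟩
  · obtain ⟨C, hC⟩ := isCompact_univ.exists_bound_of_continuousOn (hc i).continuousOn
    refine (hG i).1.of_le_mul (c := C) ((hG i).1.1.inner (hc i).aestronglyMeasurable)
      (Filter.Eventually.of_forall fun s => (abs_real_inner_le_norm _ _).trans ?_)
    rw [mul_comm]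
    have := hC s (Set.mem_univ _)
    gcongr
  · have hφc : Continuous fun s : S2 => φ s := hφ.continuous.comp continuous_subtype_val
    rw [integral_congr_ae (hw φ hφ), integral_finsetSum]
    swap
    · intro i _
      exact (hui i).integrable_mul
        (continuous_memLp (continuous_smoothDiv (hφ.smul (hF i))) 2)
    simp only [Finset.sum_mul]
    rw [integral_finsetSum]
    swap
    · intro i _
      have h := integrable_inner_of_memLp (hG i).1 (continuous_memLp (hφc.smul (hc i)) 2)
      refine h.congr (Filter.Eventually.of_forall fun s => ?_)
      simp only
      rw [Pi.smul_apply', inner_smul_right, mul_comm]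
    rw [← Finset.sum_neg_distrib]
    refine Finset.sum_congr rfl fun i _ => ?_
    have h := (hG i).2.2 (fun x => φ x • F i x) (hφ.smul (hF i)) fun s => by
      rw [inner_smul_right, hFt, mul_zero]
    rw [h, neg_neg]
    simp only [inner_smul_right, mul_comm]

lemma exists_isWeakDiv {u : S2 → E3} (hu : MemH1Tangent u) : ∃ d, IsWeakDiv u d := by
  choose G hG using fun i => (hu.2 i).2
  refine ⟨_, isWeakDiv_of_components (F := tanBasis) hu.memLp hG contDiff_tanBasis inner_tanBasis
    fun φ hφ => hu.1.mono fun s hs => ?_⟩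
  have h1 : u s = ∑ i, u s i • tanBasis i s := by
    have h2 : ∑ i, u s i • tanBasis i s = u s - ⟪(s : E3), u s⟫ • (s : E3) := by
      rw [inner_eq]
      apply ext3 <;> simp [Fin.sum_univ_three, tanBasis] <;> ring
    rw [h2, hs, zero_smul, sub_zero]
  simp only [smoothDiv_smul hφ (contDiff_tanBasis _) (inner_tanBasis _ s), smoothDiv_tanBasis]
  rw [inner_sphereGrad hs]
  conv_lhs => rw [h1]
  rw [map_sum]
  simp only [map_smul, smul_eq_mul, mul_add, Finset.sum_add_distrib]
  rw [inner_eq] at hs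
  simp only [Fin.sum_univ_three]
  linear_combination (2 * φ s) * hs

lemma exists_isWeakDiv_perp {u : S2 → E3} (hu : MemH1Tangent u) : ∃ r, IsWeakDiv (perp u) r := by
  choose G hG using fun i => (hu.2 i).2
  refine ⟨_, isWeakDiv_of_components (F := fun i => crossLeft (EuclideanSpace.single i 1))
    hu.memLp hG (fun i => (crossLeft _).contDiff) (fun i => inner_crossLeft _)
    fun φ hφ => Filter.Eventually.of_forall fun s => ?_⟩
  have h1 : perp u s = ∑ i, u s i • crossLeft (EuclideanSpace.single i 1) s := by
    rw [perp_apply]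
    apply ext3 <;> simp [Fin.sum_univ_three, crossLeft_apply] <;> ring
  simp only [smoothDiv_smul hφ (crossLeft _).contDiff (inner_crossLeft _ s), smoothDiv_crossLeft,
    mul_zero, zero_add]
  rw [inner_sphereGrad (v := perp u s) (cross_inner_self (u s) s), h1, map_sum]
  simp only [map_smul, smul_eq_mul]

lemma isWeakDiv_div {u : S2 → E3} (h : ∃ d, IsWeakDiv u d) : IsWeakDiv u (div u) := by
  rw [div, dif_pos h]; exact h.choose_spec

lemma ladyzhenskayaInequality_toNNReal : LadyzhenskayaInequality (3 * Real.pi / 32).toNNReal :=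
  fun _ hu => eLpNorm_four_pow_le hu.memLp hu.1 (isWeakDiv_div (exists_isWeakDiv hu))
    (isWeakDiv_div (exists_isWeakDiv_perp hu))

lemma isClosed_setOf_ladyzhenskayaInequality : IsClosed {c : ℝ≥0 | LadyzhenskayaInequality c} := by
  simp only [LadyzhenskayaInequality, Set.ofPred_forall]
  refine isClosed_iInter fun u => isClosed_iInter fun hu => ?_
  have hd := (isWeakDiv_div (exists_isWeakDiv hu)).1.2.ne
  have hr := (isWeakDiv_div (exists_isWeakDiv_perp hu)).1.2.ne
  have hn := hu.memLp.2.ne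
  have h : Continuous fun c : ℝ≥0 => (c : ℝ≥0∞) * (eLpNorm u 2 area ^ 2 *
      (eLpNorm (rot u) 2 area ^ 2 + eLpNorm (div u) 2 area ^ 2)) :=
    (ENNReal.continuous_mul_const (ENNReal.mul_ne_top (ENNReal.pow_ne_top hn)
      (ENNReal.add_ne_top.2 ⟨ENNReal.pow_ne_top hr, ENNReal.pow_ne_top hd⟩))).comp
      ENNReal.continuous_coe
  simp only [mul_assoc]
  exact isClosed_le continuous_const h

end SphereField

/-- Every `u ∈ H¹(T𝕊²)` has a divergence and a rotation in `L₂` (so that the right-hand side of the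
inequality is meaningful), the best constant of the inequality exists, and it is at most `3π/32`. -/
theorem corollary2p1 :
    (∀ u : SphereField.S2 → SphereField.E3, SphereField.MemH1Tangent u →
      SphereField.IsWeakDiv u (SphereField.div u) ∧
      SphereField.IsWeakDiv (SphereField.perp u) (SphereField.rot u)) ∧
    ∃ k : ℝ≥0, IsLeast {c : ℝ≥0 | SphereField.LadyzhenskayaInequality c} k ∧
      (k : ℝ) ≤ 3 * Real.pi / 32 := by
  have hmem := SphereField.ladyzhenskayaInequality_toNNReal
  refine ⟨fun u hu => ⟨SphereField.isWeakDiv_div (SphereField.exists_isWeakDiv hu),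
    SphereField.isWeakDiv_div (SphereField.exists_isWeakDiv_perp hu)⟩, _,
    ⟨SphereField.isClosed_setOf_ladyzhenskayaInequality.csInf_mem ⟨_, hmem⟩ (OrderBot.bddBelow _),
      fun c hc => csInf_le' hc⟩, ?_⟩
  rw [← Real.le_toNNReal_iff_coe_le (by positivity)]
  exact csInf_le' hmem
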